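/- **Notation.** Let $n\ge 2$. For $a,b>-1$ let $P_i^{(a,b)}$ be the Jacobi polynomial of degree $i$ normalized by $P_i^{(a,b)}(1)=1$, and let $P_i^{(n)}=P_i^{((n-3)/2,(n-3)/2)}$ be the Gegenbauer polynomials, which are orthogonal on $[-1,1]$ with respect to the probability measure $d\mu_n(t)=\gamma_n(1-t^2)^{(n-3)/2}dt$, $\gamma_n=\Gamma(\frac n2)/(\sqrt\pi\,\Gamma(\frac{n-1}2))$. For a polynomial $f=\sum_i f_iP_i^{(n)}$ we have $f_0=\int_{-1}^1 f\,d\mu_n$. For an integer $m\ge 1$ write $m=2k-1+\varepsilon$ with $k\ge 1$ and $\varepsilon\in\{0,1\}$, and put $$D(n,m)=\binom{n+k-2+\varepsilon}{n-1}+\binom{n+k-2}{n-1},$$ $$L_m(n,s)=\binom{k+n-3+\varepsilon}{n-2}\left[\frac{2k+n-3+2\varepsilon}{n-1}-\frac{(1+s)^{\varepsilon}\left(P^{(n)}_{k-1+\varepsilon}(s)-P^{(n)}_{k+\varepsilon}(s)\right)}{(1-s)\left(\varepsilon P^{(n)}_k(s)+P^{(n)}_{k+\varepsilon}(s)\right)}\right].$$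 The Levenshtein polynomial is, up to a positive factor, $$f_m^{(n,s)}(t)=(t-s)(t+1)^{\varepsilon}\Big(\sum_{i=0}^{k-1} r_i\,p_i(t)\,p_i(s)\Big)^2,$$ where $p_i=P_i^{(1+(n-3)/2,\ \varepsilon+(n-3)/2)}$ and $1/r_i=\int_{-1}^1 p_i(t)^2(1-t)(1+t)^{\varepsilon}\,d\mu_n(t)$. A weighted spherical code $(C,W)$ on $\mathbb S^{n-1}$ consists of distinct points $x_1,\dots,x_N\in\mathbb S^{n-1}$ and weights $w_i>0$ with $\sum_i w_i=1$. Its maximal inner product is $s(C)=\max_{i\ne j}x_i\cdot x_j$ (so $N\ge 2$), and $N_W=1/\sum_i w_i^2$. It is a weighted spherical $\tau$-design if $\sum_{i,j}w_iw_jP_\ell^{(n)}(x_i\cdot x_j)=0$ for $1\le \ell\le\tau$. For a function $h$ on $[-1,1)$ its weighted $h$-energy is $E_h(C,W)=\sum_{i\neq j}w_iw_jh(x_i\cdot x_j)$. **Theorem.** Let $\tau=2k-1+\varepsilon$ with $k\ge 1$, $\varepsilon\in\{0,1\}$. Let $h$ be real-valued and continuous on $[-1,1)$ and $\tau$ times differentiable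 on $(-1,1)$ with $h^{(\tau)}\ge 0$ on $(-1,1)$. Let $(C,W)$ be a weighted spherical $\tau$-design on $\mathbb S^{n-1}$ of size $N$ with maximal inner product $s=s(C)\in[-1,1)$, and assume that $N_1:=L_\tau(n,s)$ satisfies $D(n,\tau)<N_1\le D(n,\tau+1)$. Then $f_\tau^{(n,s)}$ has exactly $k+\varepsilon$ distinct real roots $\alpha_0^{(n,s)}<\dots<\alpha_{k-1+\varepsilon}^{(n,s)}=s$, all of them in $[-1,s]$, and the multiset $T$ of its real roots, counted with multiplicity, has $\tau$ elements. Let $g_T$ be the Hermite interpolating polynomial of $h$ at $T$, i.e. the unique polynomial of degree less than $\tau$ that agrees at each point of $T$ with $h$ and with the derivatives of $h$ of order less than the multiplicity of that point, and let $$\rho_i^{(n,s)}=(\ell_i)_0-\frac{\ell_i(1)}{N_1},\qquad \ell_i(t)=\prod_{j\ne i}\frac{t-\alpha_j^{(n,s)}}{\alpha_i^{(n,s)}-\alpha_j^{(n,s)}}.$$ Then $$E_h(C,W)\le\frac{(N_W-N_1)\,g_T(1)}{N_WN_1}+\sum_{i=0}^{k-1+\varepsilon}\rho_i^{(n,s)}\,h\big(\alpha_i^{(n,s)}\big).$$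 -/

import Mathlib

open Polynomial

noncomputable section

/-- The Jacobi polynomial `P_k^{(a,b)}`, normalized to take the value `1` at `t = 1`:
the hypergeometric polynomial `₂F₁(-k, k + a + b + 1; a + 1; (1 - t) / 2)`
(for `a, b > -1`). -/
def jacobiPoly (a b : ℝ) (k : ℕ) : ℝ[X] :=
  ∑ j ∈ Finset.range (k + 1),
    C ((ascPochhammer ℝ j).eval (-(k : ℝ)) * (ascPochhammer ℝ j).eval ((k : ℝ) + a + b + 1) /
        ((ascPochhammer ℝ j).eval (a + 1) * (j.factorial : ℝ))) *
      (C (1 / 2) * (1 - X)) ^ j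

/-- The Gegenbauer polynomial `P_k^{(n)}`: the Jacobi polynomial with both parameters equal to
`(n - 3) / 2`, normalized by `P_k^{(n)}(1) = 1`. -/
def gegenbauerPoly (n k : ℕ) : ℝ[X] :=
  jacobiPoly (((n : ℝ) - 3) / 2) (((n : ℝ) - 3) / 2) k

/-- The density `γ_n (1 - t ^ 2) ^ ((n - 3) / 2)` on `[-1, 1]` of the probability measure `μ_n`
with respect to which the Gegenbauer polynomials `P_k^{(n)}` are orthogonal. -/
def gegenbauerDensity (n : ℕ) (t : ℝ) : ℝ :=
  Real.Gamma ((n : ℝ) / 2) / (Real.sqrt Real.pi * Real.Gamma (((n : ℝ) - 1) / 2)) *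
    (1 - t ^ 2) ^ (((n : ℝ) - 3) / 2)

/-- The zeroth coefficient `f_0` of the expansion `f = ∑ f_i P_i^{(n)}`, that is,
`f_0 = ∫ f dμ_n`. -/
def gegenbauerCoeffZero (n : ℕ) (f : ℝ[X]) : ℝ :=
  ∫ t in (-1 : ℝ)..1, f.eval t * gegenbauerDensity n t

/-- The bound `D(n, m) = C(n + k - 2 + ε, n - 1) + C(n + k - 2, n - 1)`, where
`m = 2 k - 1 + ε` and `ε ∈ {0, 1}`, of Delsarte, Goethals and Seidel (for `n ≥ 2`, `m ≥ 1`). -/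
def dgsBound (n m : ℕ) : ℕ :=
  (n + (m + 1) / 2 - 2 + (m + 1) % 2).choose (n - 1) + (n + (m + 1) / 2 - 2).choose (n - 1)

/-- The Levenshtein bound `L_m(n, s)`, `m = 2 k - 1 + ε`. -/
def levenshteinBound (n k ε : ℕ) (s : ℝ) : ℝ :=
  ((k + n - 3 + ε).choose (n - 2) : ℝ) *
    ((2 * (k : ℝ) + n - 3 + 2 * ε) / ((n : ℝ) - 1) -
      (1 + s) ^ ε * ((gegenbauerPoly n (k - 1 + ε)).eval s - (gegenbauerPoly n (k + ε)).eval s) /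
        ((1 - s) * (ε * (gegenbauerPoly n k).eval s + (gegenbauerPoly n (k + ε)).eval s)))

/-- The adjacent polynomials `P_i^{1,ε}`: the Jacobi polynomials with parameters
`1 + (n - 3) / 2` and `ε + (n - 3) / 2`, orthogonal with respect to `(1 - t) (1 + t) ^ ε dμ_n`. -/
def adjacentPoly (n ε i : ℕ) : ℝ[X] :=
  jacobiPoly (1 + ((n : ℝ) - 3) / 2) (ε + ((n : ℝ) - 3) / 2) i

/-- The Christoffel-Darboux kernel `T_{k-1}^{1,ε}(t, s) = ∑_{i < k} r_i P_i^{1,ε}(t) P_i^{1,ε}(s)`,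
as a polynomial in `t`, where `1 / r_i = ∫ (P_i^{1,ε}(t)) ^ 2 (1 - t) (1 + t) ^ ε dμ_n(t)`. -/
def levenshteinKernel (n k ε : ℕ) (s : ℝ) : ℝ[X] :=
  ∑ i ∈ Finset.range k,
    C ((adjacentPoly n ε i).eval s /
        ∫ t in (-1 : ℝ)..1,
          (adjacentPoly n ε i).eval t ^ 2 * ((1 - t) * (1 + t) ^ ε * gegenbauerDensity n t)) *
      adjacentPoly n ε i

/-- The Levenshtein polynomial `f_m^{(n,s)}(t) = (t - s) (t + 1) ^ ε (T_{k-1}^{1,ε}(t, s)) ^ 2`,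
`m = 2 k - 1 + ε` (up to a positive constant factor, on which nothing below depends). -/
def levenshteinPoly (n k ε : ℕ) (s : ℝ) : ℝ[X] :=
  (X - C s) * (X + 1) ^ ε * levenshteinKernel n k ε s ^ 2

/-- The multiset `T` of the roots of the Levenshtein polynomial, counted with multiplicity. -/
def interpolationNodes (n k ε : ℕ) (s : ℝ) : Multiset ℝ :=
  (levenshteinPoly n k ε s).roots

/-- The set of the nodes `α_i^{(n,s)}`: the distinct roots of the Levenshtein polynomial. -/
def levenshteinNodes (n k ε : ℕ) (s : ℝ) : Finset ℝ :=
  (interpolationNodes n k ε s).toFinset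

/-- The weight `ρ_i^{(n,s)}` at the node `α = α_i^{(n,s)}`, found by substituting the
Lagrange basis polynomial `ℓ` of the nodes (with `ℓ(α) = 1`) in the quadrature formula
`f_0 = f(1) / L_m(n, s) + ∑ ρ_i f(α_i)`. -/
def levenshteinWeight (n k ε : ℕ) (s α : ℝ) : ℝ :=
  gegenbauerCoeffZero n (Lagrange.basis (levenshteinNodes n k ε s) id α) -
    (Lagrange.basis (levenshteinNodes n k ε s) id α).eval 1 / levenshteinBound n k ε s

/-- `g` is the Hermite interpolating polynomial of `h` at the multiset `T`: its degree is less than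
the size of `T`, and at each point `t` of `T` it agrees with `h` together with the derivatives
of order less than the multiplicity of `t` in `T`. -/
def IsHermiteInterpolant (h : ℝ → ℝ) (T : Multiset ℝ) (g : ℝ[X]) : Prop :=
  g.degree < (Multiset.card T : WithBot ℕ) ∧
    ∀ t ∈ T, ∀ j < T.count t, (derivative^[j] g).eval t = iteratedDeriv j h t

/-- A weighted spherical code `(C, W)` of size `N` on the unit sphere of `ℝⁿ`: distinct points
with positive weights of sum `1`. -/
structure WeightedCode (n N : ℕ) where
  point : Fin N → EuclideanSpace ℝ (Fin n)
  weight : Fin N → ℝ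
  norm_point : ∀ i, ‖point i‖ = 1
  point_injective : Function.Injective point
  weight_pos : ∀ i, 0 < weight i
  sum_weight : ∑ i, weight i = 1

namespace WeightedCode

variable {n N : ℕ}

/-- The weighted `h`-energy `E_h(C, W) = ∑_{i ≠ j} w_i w_j h(x_i · x_j)`. -/
def energy (c : WeightedCode n N) (h : ℝ → ℝ) : ℝ :=
  ∑ i, ∑ j ∈ Finset.univ.erase i,
    c.weight i * c.weight j * h (inner ℝ (c.point i) (c.point j))

/-- The weighted moment `M_ℓ(C, W)`. -/
def moment (c : WeightedCode n N) (l : ℕ) : ℝ :=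
  ∑ i, ∑ j, c.weight i * c.weight j *
    (gegenbauerPoly n l).eval (inner ℝ (c.point i) (c.point j))

/-- Weighted spherical `τ`-designs. -/
def IsDesign (c : WeightedCode n N) (τ : ℕ) : Prop :=
  ∀ l, 1 ≤ l → l ≤ τ → c.moment l = 0

/-- `s` is the maximal inner product `s(C)` of pairs of distinct points. -/
def IsMaxInner (c : WeightedCode n N) (s : ℝ) : Prop :=
  IsGreatest {r | ∃ i j, i ≠ j ∧ r = inner ℝ (c.point i) (c.point j)} s

/-- `N_W = 1 / ∑ w_i ^ 2`. -/
def effectiveSize (c : WeightedCode n N) : ℝ :=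
  1 / ∑ i, c.weight i ^ 2

end WeightedCode

end

/-! Let `g` be the Hermite interpolant. At a point x of [-1, s] that is not a node, h(x) - g(x) is
h^(τ)(ξ)/τ! times (x - s)(x + 1)^ε ∏(x - α)^2, which is nonpositive there. So h ≤ g on [-1, s]
(`le_eval_of_isHermiteInterpolant`) and E_h ≤ E_g. As g has degree below τ, the design property
turns its sum over all pairs into g_0; removing the diagonal leaves E_g = g_0 - g(1)/N_W. The
quadrature g_0 = g(1)/N_1 + ∑ ρ_i g(α_i) (`gegenbauerMean_eq_quadrature`), with g = h at the nodes,
gives the bound.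

The quadrature comes from the nodal polynomial F = (t - s)(t + 1)^ε K, with K the
Christoffel-Darboux kernel. The reproducing property of K makes F orthogonal to (1 - t)q for deg q <
k - 1, so (Fq)_0 = F_0 q(1) for deg q < k. Hence F differs from F_0 times the kernel of evaluation
at 1 by a combination of P_k, ..., P_{k+ε}. The zeros of F at s and, for ε = 1, at -1 determine it,
and evaluation at 1 gives F_0 N_1 = F(1) (`gegenbauerMean_levenshteinNodal_mul_levenshteinBound`).

The position of the nodes is deduced from the design itself. If u ≥ 0 on [-1, 1] and deg u ≤ τ - 2,
the mean of (s - t)(1 - t)u is a sum over pairs in which the diagonal vanishes and all other terms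
are nonnegative (`IsDesign.nonnegBelow`). For u = (1 + t)^(1-ε) q^2 with q ≠ 0 the mean is positive,
since its vanishing would force N_1 ≤ D(n, τ) (`levenshteinBound_le_of_orthogonal`). Thus K is an
orthogonal polynomial of degree k - 1 for a functional that is positive definite in the relevant
degrees, and its roots are simple, real and in (-1, s) (`levenshteinKernel_roots`). -/

/-! ### Beta integrals and the Jacobi weight. -/

theorem integral_rpow_mul_one_sub_rpow {x y : ℝ} (hx : 0 < x) (hy : 0 < y) :
    ∫ t in (0 : ℝ)..1, t ^ (x - 1) * (1 - t) ^ (y - 1) = ProbabilityTheory.beta x y := by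
  rw [ProbabilityTheory.beta_eq_betaIntegralReal x y hx hy, Complex.betaIntegral]
  have h : ∀ t ∈ Set.uIcc (0 : ℝ) 1,
      (t : ℂ) ^ ((x : ℂ) - 1) * (1 - (t : ℂ)) ^ ((y : ℂ) - 1)
        = ((t ^ (x - 1) * (1 - t) ^ (y - 1) : ℝ) : ℂ) := by
    intro t ht
    rw [Set.uIcc_of_le zero_le_one] at ht
    rw [Complex.ofReal_mul, Complex.ofReal_cpow ht.1, Complex.ofReal_cpow (by linarith [ht.2])]
    push_cast
    rfl
  rw [intervalIntegral.integral_congr h, intervalIntegral.integral_ofReal, Complex.ofReal_re]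

theorem intervalIntegrable_rpow_mul_one_sub_rpow {x y : ℝ} (hx : 0 < x) (hy : 0 < y) :
    IntervalIntegrable (fun t : ℝ => t ^ (x - 1) * (1 - t) ^ (y - 1))
      MeasureTheory.volume 0 1 := by
  have h := (Complex.betaIntegral_convergent (u := x) (v := y) (by simpa) (by simpa)).norm
  refine h.congr_ae ?_
  rw [Set.uIoc_of_le zero_le_one]
  refine (MeasureTheory.ae_restrict_mem measurableSet_Ioc).mono fun t ht => ?_
  have e1 : (t : ℂ) ^ ((x : ℂ) - 1) * (1 - (t : ℂ)) ^ ((y : ℂ) - 1)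
        = ((t ^ (x - 1) * (1 - t) ^ (y - 1) : ℝ) : ℂ) := by
    rw [Complex.ofReal_mul, Complex.ofReal_cpow ht.1.le, Complex.ofReal_cpow (by linarith [ht.2])]
    push_cast
    rfl
  have h1 : 0 ≤ 1 - t := by linarith [ht.2]
  have h2 : 0 ≤ t := ht.1.le
  simp only [e1, Complex.norm_real, Real.norm_eq_abs]
  exact abs_of_nonneg (by positivity)

theorem intervalIntegrable_jacobiWeight {x y : ℝ} (hx : 0 < x) (hy : 0 < y) :
    IntervalIntegrable (fun t : ℝ => (1 - t) ^ (x - 1) * (1 + t) ^ (y - 1))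
      MeasureTheory.volume (-1) 1 := by
  have h := (intervalIntegrable_rpow_mul_one_sub_rpow hy hx).comp_mul_right (c := 1 / 2)
  have h2 := (h.comp_add_right 1).const_mul (2 ^ (x - 1) * 2 ^ (y - 1))
  norm_num at h2
  refine (h2.symm.congr_ae ?_).symm
  rw [Set.uIoc_of_ge (by norm_num)]
  refine (MeasureTheory.ae_restrict_mem measurableSet_Ioc).mono fun t ht => ?_
  have h3 : 0 ≤ (t + 1) / 2 := by linarith [ht.1]
  have h4 : 0 ≤ 1 - (t + 1) / 2 := by linarith [ht.2]
  have e1 : 1 - t = 2 * (1 - (t + 1) / 2) := by ring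
  have e2 : 1 + t = 2 * ((t + 1) / 2) := by ring
  simp only []
  rw [e1, e2, Real.mul_rpow (by norm_num) h4, Real.mul_rpow (by norm_num) h3]
  ring_nf

theorem integral_jacobiWeight {x y : ℝ} (hx : 0 < x) (hy : 0 < y) :
    ∫ t in (-1 : ℝ)..1, (1 - t) ^ (x - 1) * (1 + t) ^ (y - 1)
      = 2 ^ (x + y - 1) * ProbabilityTheory.beta x y := by
  have h := intervalIntegral.integral_comp_mul_add
    (fun t : ℝ => (1 - t) ^ (x - 1) * (1 + t) ^ (y - 1)) (a := 0) (b := 1)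
    (two_ne_zero' ℝ) (-1)
  norm_num at h
  have h2 : ∫ t in (0 : ℝ)..1, (1 - (2 * t + -1)) ^ (x - 1) * (2 * t) ^ (y - 1)
      = ∫ t in (0 : ℝ)..1, (2 ^ (x - 1) * 2 ^ (y - 1)) * (t ^ (y - 1) * (1 - t) ^ (x - 1)) := by
    refine intervalIntegral.integral_congr fun t ht => ?_
    rw [Set.uIcc_of_le zero_le_one] at ht
    have e1 : 1 - (2 * t + -1) = 2 * (1 - t) := by ring
    simp only [e1]
    rw [Real.mul_rpow (by norm_num) (by linarith [ht.2]), Real.mul_rpow (by norm_num) ht.1]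
    ring
  rw [h2, intervalIntegral.integral_const_mul, integral_rpow_mul_one_sub_rpow hy hx] at h
  have h3 : ProbabilityTheory.beta y x = ProbabilityTheory.beta x y := by
    unfold ProbabilityTheory.beta; rw [add_comm y x, mul_comm (Real.Gamma y)]
  rw [h3, ← Real.rpow_add two_pos] at h
  have h4 : (2 : ℝ) ^ (x + y - 1) = 2 * 2 ^ (x - 1 + (y - 1)) := by
    rw [show x + y - 1 = 1 + (x - 1 + (y - 1)) by ring, Real.rpow_add two_pos, Real.rpow_one]
  rw [h4]
  linarith

theorem Gamma_add_nat {x : ℝ} (hx : 0 < x) (j : ℕ) :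
    Real.Gamma (x + j) = (ascPochhammer ℝ j).eval x * Real.Gamma x := by
  induction j with
  | zero => simp
  | succ j ih =>
    rw [ascPochhammer_succ_eval, Nat.cast_succ, ← add_assoc, Real.Gamma_add_one (by positivity), ih]
    ring

/-! ### The mean f ↦ f_0: integrability, positivity, moments. -/

theorem gegenbauerDensity_eq {n : ℕ} {t : ℝ} (ht : t ∈ Set.Ioo (-1 : ℝ) 1) :
    gegenbauerDensity n t =
      Real.Gamma ((n : ℝ) / 2) / (Real.sqrt Real.pi * Real.Gamma (((n : ℝ) - 1) / 2)) *
        ((1 - t) ^ (((n : ℝ) - 1) / 2 - 1) * (1 + t) ^ (((n : ℝ) - 1) / 2 - 1)) := by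
  have h1 : 0 ≤ 1 - t := by linarith [ht.2]
  have h2 : 0 ≤ 1 + t := by linarith [ht.1]
  rw [gegenbauerDensity, show 1 - t ^ 2 = (1 - t) * (1 + t) by ring, Real.mul_rpow h1 h2,
    show ((n : ℝ) - 3) / 2 = ((n : ℝ) - 1) / 2 - 1 by ring]

theorem gegenbauerDensity_pos {n : ℕ} (hn : 2 ≤ n) {t : ℝ} (ht : t ∈ Set.Ioo (-1 : ℝ) 1) :
    0 < gegenbauerDensity n t := by
  have hn' : (2 : ℝ) ≤ n := by exact_mod_cast hn
  have h1 : 0 < 1 - t := by linarith [ht.2]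
  have h2 : 0 < 1 + t := by linarith [ht.1]
  have h3 := Real.Gamma_pos_of_pos (show 0 < (n : ℝ) / 2 by linarith)
  have h4 := Real.Gamma_pos_of_pos (show 0 < ((n : ℝ) - 1) / 2 by linarith)
  rw [gegenbauerDensity_eq ht]
  have := Real.pi_pos
  positivity

theorem ae_mem_Ioo :
    ∀ᵐ t ∂(MeasureTheory.volume : MeasureTheory.Measure ℝ).restrict (Set.uIoc (-1) 1),
      t ∈ Set.Ioo (-1 : ℝ) 1 := by
  rw [Set.uIoc_of_le (by norm_num), ← MeasureTheory.Measure.restrict_congr_set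
    (MeasureTheory.Ioo_ae_eq_Ioc (μ := MeasureTheory.volume) (a := (-1 : ℝ)) (b := 1))]
  exact MeasureTheory.ae_restrict_mem measurableSet_Ioo

theorem intervalIntegrable_gegenbauerDensity {n : ℕ} (hn : 2 ≤ n) :
    IntervalIntegrable (gegenbauerDensity n) MeasureTheory.volume (-1) 1 := by
  have hn' : (2 : ℝ) ≤ n := by exact_mod_cast hn
  have hc : 0 < ((n : ℝ) - 1) / 2 := by linarith
  refine ((intervalIntegrable_jacobiWeight hc hc).const_mul (Real.Gamma ((n : ℝ) / 2) /
    (Real.sqrt Real.pi * Real.Gamma (((n : ℝ) - 1) / 2)))).congr_ae ?_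
  exact ae_mem_Ioo.mono fun t ht => (gegenbauerDensity_eq ht).symm

theorem intervalIntegrable_eval_mul_gegenbauerDensity {n : ℕ} (hn : 2 ≤ n) (f : ℝ[X]) :
    IntervalIntegrable (fun t => f.eval t * gegenbauerDensity n t) MeasureTheory.volume (-1) 1 :=
  (intervalIntegrable_gegenbauerDensity hn).continuousOn_mul f.continuous.continuousOn

theorem gegenbauerCoeffZero_add {n : ℕ} (hn : 2 ≤ n) (f g : ℝ[X]) :
    gegenbauerCoeffZero n (f + g) = gegenbauerCoeffZero n f + gegenbauerCoeffZero n g := by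
  rw [gegenbauerCoeffZero, gegenbauerCoeffZero, gegenbauerCoeffZero,
    ← intervalIntegral.integral_add (intervalIntegrable_eval_mul_gegenbauerDensity hn f)
      (intervalIntegrable_eval_mul_gegenbauerDensity hn g)]
  simp only [eval_add, add_mul]

theorem gegenbauerCoeffZero_C_mul {n : ℕ} (a : ℝ) (f : ℝ[X]) :
    gegenbauerCoeffZero n (C a * f) = a * gegenbauerCoeffZero n f := by
  rw [gegenbauerCoeffZero, gegenbauerCoeffZero, ← intervalIntegral.integral_const_mul]
  simp only [eval_mul, eval_C, mul_assoc]

/-- `f ↦ f_0` as a linear functional on the polynomials. -/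
noncomputable def gegenbauerMean {n : ℕ} (hn : 2 ≤ n) : ℝ[X] →ₗ[ℝ] ℝ where
  toFun := gegenbauerCoeffZero n
  map_add' := gegenbauerCoeffZero_add hn
  map_smul' a f := by rw [smul_eq_C_mul, gegenbauerCoeffZero_C_mul]; rfl

theorem gegenbauerMean_apply {n : ℕ} (hn : 2 ≤ n) (f : ℝ[X]) :
    gegenbauerMean hn f = gegenbauerCoeffZero n f := rfl

theorem gegenbauerMean_C_mul {n : ℕ} (hn : 2 ≤ n) (a : ℝ) (f : ℝ[X]) :
    gegenbauerMean hn (C a * f) = a * gegenbauerMean hn f := gegenbauerCoeffZero_C_mul a f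

theorem gegenbauerMean_nonneg {n : ℕ} (hn : 2 ≤ n) {f : ℝ[X]}
    (hf : ∀ t ∈ Set.Ioo (-1 : ℝ) 1, 0 ≤ f.eval t) : 0 ≤ gegenbauerMean hn f := by
  rw [gegenbauerMean_apply, gegenbauerCoeffZero]
  refine intervalIntegral.integral_nonneg_of_ae_restrict (by norm_num) ?_
  have := ae_mem_Ioo
  rw [Set.uIoc_of_le (by norm_num), MeasureTheory.Measure.restrict_congr_set
    (MeasureTheory.Ioc_ae_eq_Icc (μ := MeasureTheory.volume))] at this
  exact this.mono fun t ht => mul_nonneg (hf t ht) (gegenbauerDensity_pos hn ht).le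

/-- A nonzero polynomial vanishes only on a finite, hence null, set. -/
theorem gegenbauerMean_pos {n : ℕ} (hn : 2 ≤ n) {f : ℝ[X]}
    (hf : ∀ t ∈ Set.Ioo (-1 : ℝ) 1, 0 ≤ f.eval t) (h0 : f ≠ 0) : 0 < gegenbauerMean hn f := by
  rw [gegenbauerMean_apply, gegenbauerCoeffZero, intervalIntegral.integral_pos_iff_support_of_nonneg_ae'
    _ (intervalIntegrable_eval_mul_gegenbauerDensity hn f)]
  · refine ⟨by norm_num, ?_⟩
    have hsub : Set.Ioo (-1 : ℝ) 1 \ (f.roots.toFinset : Set ℝ) ⊆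
        (Function.support fun t => f.eval t * gegenbauerDensity n t) ∩ Set.Ioc (-1) 1 := by
      rintro t ⟨ht, hr⟩
      refine ⟨?_, ht.1, ht.2.le⟩
      have : f.eval t ≠ 0 := by simpa [h0] using hr
      exact mul_ne_zero this (gegenbauerDensity_pos hn ht).ne'
    refine lt_of_lt_of_le ?_ (MeasureTheory.measure_mono hsub)
    rw [MeasureTheory.measure_sdiff_null (Finset.measure_zero _ _), Real.volume_Ioo]
    norm_num
  · exact ae_mem_Ioo.mono fun t ht => mul_nonneg (hf t ht) (gegenbauerDensity_pos hn ht).le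

/-- A beta integral; the duplication formula for Γ absorbs the constant γ_n and leaves only
Pochhammer symbols. -/
theorem gegenbauerMean_moment {n : ℕ} (hn : 2 ≤ n) (i j : ℕ) :
    gegenbauerMean hn ((1 - X) ^ i * (1 + X) ^ j) =
      2 ^ (i + j) * (ascPochhammer ℝ i).eval (((n : ℝ) - 1) / 2) *
        (ascPochhammer ℝ j).eval (((n : ℝ) - 1) / 2) / (ascPochhammer ℝ (i + j)).eval ((n : ℝ) - 1) := by
  have hn' : (2 : ℝ) ≤ n := by exact_mod_cast hn
  have hc : 0 < ((n : ℝ) - 1) / 2 := by linarith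
  obtain ⟨c, hcn⟩ : ∃ c : ℝ, c = ((n : ℝ) - 1) / 2 := ⟨_, rfl⟩
  have e2 : ∫ t in (-1 : ℝ)..1, ((1 - X) ^ i * (1 + X) ^ j : ℝ[X]).eval t * gegenbauerDensity n t
      = ∫ t in (-1 : ℝ)..1, (Real.Gamma ((n : ℝ) / 2) /
          (Real.sqrt Real.pi * Real.Gamma (((n : ℝ) - 1) / 2))) *
        ((1 - t) ^ ((c + i) - 1) * (1 + t) ^ ((c + j) - 1)) := by
    refine intervalIntegral.integral_congr_ae_restrict (ae_mem_Ioo.mono fun t ht => ?_)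
    have h1 : 0 < 1 - t := by linarith [ht.2]
    have h2 : 0 < 1 + t := by linarith [ht.1]
    simp only []
    rw [gegenbauerDensity_eq ht, ← hcn, show c + i - 1 = (c - 1) + i by ring,
      show c + j - 1 = (c - 1) + j by ring, Real.rpow_add_natCast h1.ne', Real.rpow_add_natCast h2.ne']
    simp
    ring
  rw [gegenbauerMean_apply, gegenbauerCoeffZero, e2, intervalIntegral.integral_const_mul]
  rw [← hcn] at hc ⊢
  rw [integral_jacobiWeight (by positivity) (by positivity), ProbabilityTheory.beta,
    show (n : ℝ) / 2 = c + 1 / 2 by rw [hcn]; ring, show (n : ℝ) - 1 = 2 * c by rw [hcn]; ring,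
    show c + (i : ℝ) + (c + j) = 2 * c + ((i + j : ℕ) : ℝ) by push_cast; ring,
    Gamma_add_nat hc, Gamma_add_nat hc, Gamma_add_nat (by positivity)]
  have hdup := Real.Gamma_mul_Gamma_add_half c
  have g1 := Real.Gamma_pos_of_pos hc
  have g2 := Real.Gamma_pos_of_pos (show 0 < 2 * c by positivity)
  have g3 := ascPochhammer_pos (i + j) (2 * c) (by positivity)
  have g4 := Real.sqrt_pos.2 Real.pi_pos
  have e3 : Real.Gamma (c + 1 / 2) = Real.Gamma (2 * c) * 2 ^ (1 - 2 * c) * √Real.pi / Real.Gamma c := by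
    rw [eq_div_iff g1.ne', ← hdup, mul_comm]
  have e4 : (2 : ℝ) ^ (2 * c + ((i + j : ℕ) : ℝ) - 1) = 2 ^ (i + j) / 2 ^ (1 - 2 * c) := by
    rw [show 2 * c + ((i + j : ℕ) : ℝ) - 1 = ((i + j : ℕ) : ℝ) - (1 - 2 * c) by ring,
      Real.rpow_sub two_pos, Real.rpow_natCast]
  have g5 : (0 : ℝ) < 2 ^ (1 - 2 * c) := by positivity
  rw [e3, e4]
  field_simp

theorem gegenbauerMean_one {n : ℕ} (hn : 2 ≤ n) : gegenbauerMean hn 1 = 1 := by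
  simpa using gegenbauerMean_moment hn 0 0

/-! ### Orthogonality of the Jacobi polynomials. -/

/-- A polynomial of degree at most `k`, corrected by a multiple of one of degree exactly `k`. -/
theorem exists_degree_sub_C_mul_lt {q p : ℝ[X]} {k : ℕ} (hq : q.degree < (k + 1 : ℕ))
    (hp : p.degree = k) : ∃ a : ℝ, (q - C a * p).degree < k := by
  have hp0 : p.coeff k ≠ 0 := by
    have hpn := natDegree_eq_of_degree_eq_some hp
    rw [← hpn, coeff_natDegree, Ne, leadingCoeff_eq_zero]
    rintro rfl
    simp at hp
  refine ⟨q.coeff k / p.coeff k, ?_⟩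
  rw [degree_lt_iff_coeff_zero] at hq ⊢
  intro m hm
  rcases hm.eq_or_lt with rfl | hlt
  · rw [coeff_sub, coeff_C_mul, div_mul_cancel₀ _ hp0, sub_self]
  · rw [coeff_sub, coeff_C_mul, hq m hlt, coeff_eq_zero_of_degree_lt (p := p) (n := m)
      (by rw [hp]; exact_mod_cast hlt)]
    simp

/-- One test polynomial of each degree suffices. Orthogonality, the reproducing property and the
design identity are all checked in this way. -/
theorem linearMap_eq_zero_of_degree_lt (φ : ℝ[X] →ₗ[ℝ] ℝ) (b : ℕ → ℝ[X])
    (hb : ∀ m, (b m).degree = m) {k : ℕ} (h0 : ∀ m < k, φ (b m) = 0) {q : ℝ[X]}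
    (hq : q.degree < k) : φ q = 0 := by
  induction k generalizing q with
  | zero =>
    have : q = 0 := by simpa [Nat.WithBot.lt_zero_iff] using hq
    rw [this, map_zero]
  | succ k ih =>
    obtain ⟨a, ha⟩ := exists_degree_sub_C_mul_lt hq (hb k)
    have h1 := ih (fun m hm => h0 m (hm.trans (Nat.lt_succ_self k))) ha
    rwa [map_sub, ← smul_eq_C_mul, map_smul, h0 k (Nat.lt_succ_self k), smul_zero, sub_zero] at h1

theorem ascPochhammer_eval_add (i j : ℕ) (x : ℝ) :
    (ascPochhammer ℝ (i + j)).eval x =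
      (ascPochhammer ℝ i).eval x * (ascPochhammer ℝ j).eval (x + i) := by
  rw [← ascPochhammer_mul, eval_mul, eval_comp]; simp

theorem ascPochhammer_eval_neg_natCast (k j : ℕ) :
    (ascPochhammer ℝ j).eval (-(k : ℝ)) = (-1) ^ j * (j.factorial * k.choose j) := by
  rw [ascPochhammer_eval_neg_eq_descPochhammer, descPochhammer_eval_eq_descFactorial,
    Nat.descFactorial_eq_factorial_mul_choose]
  push_cast; ring

/-- The coefficients of the Jacobi polynomials in the powers of `(1 - X) / 2`. -/
noncomputable def jacobiCoeff (a b : ℝ) (k j : ℕ) : ℝ :=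
  (ascPochhammer ℝ j).eval (-(k : ℝ)) * (ascPochhammer ℝ j).eval ((k : ℝ) + a + b + 1) /
    ((ascPochhammer ℝ j).eval (a + 1) * (j.factorial : ℝ))

theorem jacobiCoeff_eq_zero_of_lt {a b : ℝ} {k j : ℕ} (h : k < j) : jacobiCoeff a b k j = 0 := by
  rw [jacobiCoeff, ascPochhammer_eval_neg_coe_nat_of_lt h, zero_mul, zero_div]

theorem jacobiPoly_eq_sum_range {a b : ℝ} {k M : ℕ} (h : k < M) :
    jacobiPoly a b k =
      ∑ j ∈ Finset.range M, C (jacobiCoeff a b k j) * (C (1 / 2) * (1 - X)) ^ j := by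
  refine Finset.sum_subset (Finset.range_subset_range.2 h) fun j _ hj => ?_
  have : jacobiCoeff a b k j = 0 := jacobiCoeff_eq_zero_of_lt (by simpa using hj)
  rw [jacobiCoeff] at this
  rw [this, C_0, zero_mul]

theorem jacobiPoly_eval_one (a b : ℝ) (k : ℕ) : (jacobiPoly a b k).eval 1 = 1 := by
  rw [jacobiPoly_eq_sum_range (Nat.lt_succ_self k), eval_finsetSum,
    Finset.sum_eq_single_of_mem 0 (by simp)]
  · simp [jacobiCoeff]
  · intro j _ hj
    simp [hj]

theorem degree_C_half_mul_one_sub_X : (C (1 / 2) * (1 - X) : ℝ[X]).degree = 1 := by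
  rw [degree_C_mul (by norm_num), ← degree_neg, neg_sub, ← C_1, degree_X_sub_C]

theorem jacobiPoly_degree {a b : ℝ} (ha : -1 < a) (hb : -1 < b) (k : ℕ) :
    (jacobiPoly a b k).degree = k := by
  rw [jacobiPoly_eq_sum_range (Nat.lt_succ_self k), Finset.sum_range_succ]
  have hc : jacobiCoeff a b k k ≠ 0 := by
    rw [jacobiCoeff, ascPochhammer_eval_neg_natCast]
    have h1 := ascPochhammer_pos k (a + 1) (by linarith)
    have h2 : (ascPochhammer ℝ k).eval ((k : ℝ) + a + b + 1) ≠ 0 := by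
      rcases Nat.eq_zero_or_pos k with rfl | hk
      · simp
      · have : (1 : ℝ) ≤ k := by exact_mod_cast hk
        exact (ascPochhammer_pos k _ (by linarith)).ne'
    have h3 := k.factorial_pos
    simp only [Nat.choose_self]
    positivity
  have hd : (C (jacobiCoeff a b k k) * (C (1 / 2) * (1 - X)) ^ k).degree = (k : WithBot ℕ) := by
    rw [degree_C_mul hc, degree_pow, degree_C_half_mul_one_sub_X]; simp
  rw [degree_add_eq_right_of_degree_lt, hd]
  rw [hd]
  rw [← mem_degreeLT]
  refine Submodule.sum_mem _ fun j hj => ?_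
  rw [mem_degreeLT]
  rw [← smul_eq_C_mul]
  refine (degree_smul_le _ _).trans_lt ?_
  rw [degree_pow, degree_C_half_mul_one_sub_X]
  simpa using hj

/-- Up to sign, the sum is the k-th forward difference of `Q` at `y`. -/
theorem sum_neg_one_pow_mul_choose_mul_eval {k : ℕ} {Q : ℝ[X]} (hQ : Q.natDegree < k) (y : ℝ) :
    ∑ j ∈ Finset.range (k + 1), (-1 : ℝ) ^ j * k.choose j * Q.eval (y + j) = 0 := by
  have h := congr_fun (fwdDiff_iter_eq_zero_of_degree_lt hQ) y
  rw [fwdDiff_iter_eq_sum_shift] at h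
  have h2 : ∑ j ∈ Finset.range (k + 1), (-1 : ℝ) ^ j * k.choose j * Q.eval (y + j)
      = (-1) ^ k * ∑ j ∈ Finset.range (k + 1),
        ((-1 : ℤ) ^ (k - j) * (k.choose j : ℤ)) • Q.eval (y + j • 1) := by
    rw [Finset.mul_sum]
    refine Finset.sum_congr rfl fun j hj => ?_
    have hjk : j ≤ k := Nat.lt_succ_iff.1 (Finset.mem_range.1 hj)
    obtain ⟨d, rfl⟩ := Nat.exists_eq_add_of_le hjk
    have e : (-1 : ℝ) ^ d * (-1) ^ d = 1 := by rw [← mul_pow]; simp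
    rw [Nat.add_sub_cancel_left, zsmul_eq_mul, nsmul_one, pow_add]
    push_cast
    linear_combination (-((-1 : ℝ) ^ j * (j + d).choose j * Q.eval (y + j))) * e
  rw [h2, h]; simp

/-- Orthogonality of the Jacobi polynomials with parameters `α + u`, `α + v`, in terms of the
mean with parameters `α = (n - 3) / 2`. -/
theorem gegenbauerMean_jacobiPoly_mul_pow {n : ℕ} (hn : 2 ≤ n) (u v : ℕ) {k m : ℕ} (hm : m < k) :
    gegenbauerMean hn (jacobiPoly (u + ((n : ℝ) - 3) / 2) (v + ((n : ℝ) - 3) / 2) k *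
      ((1 - X) ^ u * (1 + X) ^ v) * (1 + X) ^ m) = 0 := by
  have hn' : (2 : ℝ) ≤ n := by exact_mod_cast hn
  obtain ⟨d, rfl⟩ := Nat.exists_eq_add_of_lt hm
  obtain ⟨c, hcn⟩ : ∃ c : ℝ, c = ((n : ℝ) - 1) / 2 := ⟨_, rfl⟩
  have hc : 0 < c := by rw [hcn]; linarith
  have e1 : ((n : ℝ) - 3) / 2 = c - 1 := by rw [hcn]; ring
  have e2 : (n : ℝ) - 1 = 2 * c := by rw [hcn]; ring
  rw [e1, jacobiPoly_eq_sum_range (Nat.lt_succ_self _), Finset.sum_mul, Finset.sum_mul, map_sum]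
  have hy : 0 < 2 * c + (u + v + m : ℕ) := by positivity
  set y : ℝ := 2 * c + (u + v + m : ℕ) with hydef
  set A : ℝ := 2 ^ (u + v + m) * (ascPochhammer ℝ u).eval c * (ascPochhammer ℝ (v + m)).eval c /
    ((ascPochhammer ℝ (u + v + m)).eval (2 * c) * (ascPochhammer ℝ d).eval y) with hA
  -- The test polynomials (1 + X)^m keep every moment in closed form. By (y + d)_j (y)_d = (y)_j (y
  -- + j)_d, all dependence on j collapses to an alternating binomial times a polynomial of degree d
  -- < m + d + 1, so the sum is a vanishing finite difference.
  have hterm : ∀ j ∈ Finset.range (m + d + 1 + 1),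
      gegenbauerMean hn (C (jacobiCoeff (u + (c - 1)) (v + (c - 1)) (m + d + 1) j) *
        (C (1 / 2) * (1 - X)) ^ j * ((1 - X) ^ u * (1 + X) ^ v) * (1 + X) ^ m)
      = A * ((-1 : ℝ) ^ j * (m + d + 1).choose j * (ascPochhammer ℝ d).eval (y + j)) := by
    intro j _
    have e3 : (C (jacobiCoeff (u + (c - 1)) (v + (c - 1)) (m + d + 1) j) *
        (C (1 / 2) * (1 - X)) ^ j * ((1 - X) ^ u * (1 + X) ^ v) * (1 + X) ^ m : ℝ[X])
        = C (jacobiCoeff (u + (c - 1)) (v + (c - 1)) (m + d + 1) j * (1 / 2) ^ j) *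
          ((1 - X) ^ (u + j) * (1 + X) ^ (v + m)) := by
      rw [C_mul, C_pow, mul_pow]; ring
    rw [e3, gegenbauerMean_C_mul, gegenbauerMean_moment, ← hcn, e2,
      show u + j + (v + m) = (u + v + m) + j by ring, ascPochhammer_eval_add u j,
      ascPochhammer_eval_add (u + v + m) j, ← hydef, jacobiCoeff, ascPochhammer_eval_neg_natCast,
      show (u : ℝ) + (c - 1) + 1 = c + u by ring,
      show ((m + d + 1 : ℕ) : ℝ) + (u + (c - 1)) + (v + (c - 1)) + 1 = y + d by
        rw [hydef]; push_cast; ring]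
    have h1 := ascPochhammer_eval_add d j y
    rw [add_comm d j, ascPochhammer_eval_add j d y] at h1
    have p1 := ascPochhammer_pos d y hy
    have p2 := ascPochhammer_pos j y hy
    have p3 := ascPochhammer_pos j (c + u) (by positivity)
    have p4 := ascPochhammer_pos (u + v + m) (2 * c) (by positivity)
    have p5 : (0 : ℝ) < j.factorial := by exact_mod_cast j.factorial_pos
    have h2 : (ascPochhammer ℝ j).eval (y + d) = (ascPochhammer ℝ j).eval y *
        (ascPochhammer ℝ d).eval (y + j) / (ascPochhammer ℝ d).eval y := by
      rw [eq_div_iff p1.ne']; linarith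
    have h3 : (1 / 2 : ℝ) ^ j = 1 / 2 ^ j := by rw [div_pow, one_pow]
    rw [h2, hA, pow_add 2 (u + v + m) j, h3]
    field_simp
  rw [Finset.sum_congr rfl hterm, ← Finset.mul_sum,
    sum_neg_one_pow_mul_choose_mul_eval (by rw [ascPochhammer_natDegree]; lia), mul_zero]

theorem degree_one_add_X_pow (m : ℕ) : ((1 + X : ℝ[X]) ^ m).degree = m := by
  rw [degree_pow, add_comm, ← C_1, degree_X_add_C]; simp

theorem gegenbauerMean_jacobiPoly_mul {n : ℕ} (hn : 2 ≤ n) (u v : ℕ) {k : ℕ} {q : ℝ[X]}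
    (hq : q.degree < k) :
    gegenbauerMean hn (jacobiPoly (u + ((n : ℝ) - 3) / 2) (v + ((n : ℝ) - 3) / 2) k *
      ((1 - X) ^ u * (1 + X) ^ v) * q) = 0 :=
  linearMap_eq_zero_of_degree_lt (gegenbauerMean hn ∘ₗ LinearMap.mulLeft ℝ
    (jacobiPoly (u + ((n : ℝ) - 3) / 2) (v + ((n : ℝ) - 3) / 2) k * ((1 - X) ^ u * (1 + X) ^ v)))
    (fun m => (1 + X) ^ m) degree_one_add_X_pow
    (fun _ hm => gegenbauerMean_jacobiPoly_mul_pow hn u v hm) hq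

/-! ### Gegenbauer polynomials: three-term recurrence and values at -1. -/

theorem gegenbauerPoly_degree {n : ℕ} (hn : 2 ≤ n) (k : ℕ) : (gegenbauerPoly n k).degree = k := by
  have hn' : (2 : ℝ) ≤ n := by exact_mod_cast hn
  exact jacobiPoly_degree (by linarith) (by linarith) k

theorem gegenbauerPoly_eval_one (n k : ℕ) : (gegenbauerPoly n k).eval 1 = 1 :=
  jacobiPoly_eval_one _ _ _

theorem gegenbauerMean_gegenbauerPoly_mul {n : ℕ} (hn : 2 ≤ n) {k : ℕ} {q : ℝ[X]}
    (hq : q.degree < k) : gegenbauerMean hn (gegenbauerPoly n k * q) = 0 := by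
  simpa [gegenbauerPoly] using gegenbauerMean_jacobiPoly_mul hn 0 0 hq

theorem gegenbauerPoly_zero (n : ℕ) : gegenbauerPoly n 0 = 1 := by
  simp [gegenbauerPoly, jacobiPoly]

theorem gegenbauerPoly_one {n : ℕ} (hn : 2 ≤ n) : gegenbauerPoly n 1 = X := by
  have hn' : (2 : ℝ) ≤ n := by exact_mod_cast hn
  have h : ((n : ℝ) - 3) / 2 + 1 ≠ 0 := by
    have : 0 < ((n : ℝ) - 3) / 2 + 1 := by linarith
    exact this.ne'
  have e : -((1 : ℝ) + ((n : ℝ) - 3) / 2 + ((n : ℝ) - 3) / 2 + 1) / (((n : ℝ) - 3) / 2 + 1)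
      = -2 := by
    rw [div_eq_iff h]; ring
  have e2 : (C (1 / 2) * 2 : ℝ[X]) = 1 := by
    rw [← C_ofNat, ← C_mul]; norm_num
  rw [gegenbauerPoly, jacobiPoly, Finset.sum_range_succ, Finset.sum_range_one]
  simp only [ascPochhammer_zero, ascPochhammer_one, eval_one, eval_X, Nat.factorial, pow_zero,
    pow_one, Nat.cast_one, mul_one, div_one, C_1, neg_mul, one_mul, Nat.succ_eq_add_one, zero_add]
  rw [e]
  simp only [C_neg, C_ofNat]
  linear_combination (X - 1) * e2

/-- The three-term recurrence read off at the power j + 1 of (1 - X)/2. All Pochhammer symbols are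
reduced to the two values `A` and `B`. -/
theorem jacobiCoeff_recurrence {c : ℝ} (hc : 0 < c) (k j : ℕ) :
    ((k : ℝ) + 2 * c) * jacobiCoeff (c - 1) (c - 1) (k + 2) (j + 1) =
      (2 * k + 2 * c + 1) * (jacobiCoeff (c - 1) (c - 1) (k + 1) (j + 1)
        - 2 * jacobiCoeff (c - 1) (c - 1) (k + 1) j)
        - (k + 1) * jacobiCoeff (c - 1) (c - 1) k (j + 1) := by
  have left (x : ℝ) (i : ℕ) : (ascPochhammer ℝ (i + 1)).eval x =
      x * (ascPochhammer ℝ i).eval (x + 1) := by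
    rw [add_comm, ascPochhammer_eval_add]; simp
  have p1 := ascPochhammer_pos j c hc
  have p2 : (0 : ℝ) < j.factorial := by exact_mod_cast j.factorial_pos
  obtain ⟨A, hA⟩ : ∃ A, A = (ascPochhammer ℝ j).eval (-((k : ℝ) + 1)) := ⟨_, rfl⟩
  obtain ⟨B, hB⟩ : ∃ B, B = (ascPochhammer ℝ j).eval ((k : ℝ) + 2 * c) := ⟨_, rfl⟩
  have a1 : (ascPochhammer ℝ (j + 1)).eval (-((k : ℝ) + 1)) = A * (j - (k + 1)) := by
    rw [ascPochhammer_succ_eval, ← hA]; ring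
  have a2 : (ascPochhammer ℝ (j + 1)).eval (-((k : ℝ) + 2)) = -(k + 2) * A := by
    rw [left, hA]; ring_nf
  -- The symbol (-(k + 1))_{j+2} is split off at either end. The factor k + 1 is kept on the left so
  -- that nothing is divided.
  have a3 : (k + 1) * (ascPochhammer ℝ (j + 1)).eval (-(k : ℝ))
      = -(A * (j - (k + 1)) * (j - k)) := by
    have h1 := left (-((k : ℝ) + 1)) (j + 1)
    rw [ascPochhammer_succ_eval, a1, show -((k : ℝ) + 1) + 1 = -k by ring] at h1
    push_cast at h1
    linear_combination h1
  have b1 : (ascPochhammer ℝ (j + 1)).eval ((k : ℝ) + 2 * c) = B * (k + 2 * c + j) := by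
    rw [ascPochhammer_succ_eval, ← hB]
  have b2 : (k + 2 * c) * (ascPochhammer ℝ (j + 1)).eval ((k : ℝ) + 2 * c + 1)
      = B * (k + 2 * c + j) * (k + 2 * c + j + 1) := by
    rw [← left, ascPochhammer_succ_eval, b1]; push_cast; ring
  have b3 : (ascPochhammer ℝ (j + 1)).eval ((k : ℝ) + 2 * c - 1) = (k + 2 * c - 1) * B := by
    rw [left, hB]; ring_nf
  simp only [jacobiCoeff]
  push_cast
  rw [show (k : ℝ) + 2 + (c - 1) + (c - 1) + 1 = k + 2 * c + 1 by ring,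
    show (k : ℝ) + 1 + (c - 1) + (c - 1) + 1 = k + 2 * c by ring,
    show (k : ℝ) + (c - 1) + (c - 1) + 1 = k + 2 * c - 1 by ring, sub_add_cancel,
    a1, a2, b1, b3, ← hA, ← hB, ascPochhammer_succ_eval j c, Nat.factorial_succ]
  have p3 : 0 < c + j := by positivity
  have p4 : (0 : ℝ) < (j : ℝ) + 1 := by positivity
  push_cast
  field_simp
  linear_combination (-((k : ℝ) + 2) * A) * b2 + ((k + 2 * c - 1) * B) * a3

theorem gegenbauerPoly_recurrence {n : ℕ} (hn : 2 ≤ n) (k : ℕ) :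
    C ((k : ℝ) + n - 1) * gegenbauerPoly n (k + 2) =
      C (2 * (k : ℝ) + n) * X * gegenbauerPoly n (k + 1) - C ((k : ℝ) + 1) * gegenbauerPoly n k := by
  have hn' : (2 : ℝ) ≤ n := by exact_mod_cast hn
  obtain ⟨c, hcn⟩ : ∃ c : ℝ, c = ((n : ℝ) - 1) / 2 := ⟨_, rfl⟩
  have hc : 0 < c := by rw [hcn]; linarith
  have e1 : ((n : ℝ) - 3) / 2 = c - 1 := by rw [hcn]; ring
  have e2 : (n : ℝ) = 2 * c + 1 := by rw [hcn]; ring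
  simp only [gegenbauerPoly]
  rw [e1, e2]
  set u : ℝ[X] := C (1 / 2) * (1 - X) with hu
  -- In the variable u, multiplication by X = 1 - 2u shifts coefficients by one.
  have hX : (X : ℝ[X]) = 1 - C 2 * u := by
    rw [hu, ← mul_assoc, ← C_mul]; norm_num
  have hzero (i : ℕ) : jacobiCoeff (c - 1) (c - 1) i 0 = 1 := by simp [jacobiCoeff]
  have hsum (i : ℕ) (hi : i < k + 4) : jacobiPoly (c - 1) (c - 1) i = 1 +
      ∑ j ∈ Finset.range (k + 3), C (jacobiCoeff (c - 1) (c - 1) i (j + 1)) * (u ^ j * u) := by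
    rw [jacobiPoly_eq_sum_range hi, Finset.sum_range_succ', hzero, add_comm]
    simp only [pow_succ, hu, pow_zero, C_1, mul_one]
  have hsum2 : C 2 * u * jacobiPoly (c - 1) (c - 1) (k + 1) =
      ∑ j ∈ Finset.range (k + 3), C (2 * jacobiCoeff (c - 1) (c - 1) (k + 1) j) * (u ^ j * u) := by
    rw [jacobiPoly_eq_sum_range (show k + 1 < k + 3 by lia), Finset.mul_sum]
    refine Finset.sum_congr rfl fun j _ => ?_
    rw [C_mul]; ring
  have hXP : X * jacobiPoly (c - 1) (c - 1) (k + 1) = 1 +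
      ∑ j ∈ Finset.range (k + 3), C (jacobiCoeff (c - 1) (c - 1) (k + 1) (j + 1)
        - 2 * jacobiCoeff (c - 1) (c - 1) (k + 1) j) * (u ^ j * u) := by
    conv_lhs => rw [hX, sub_mul, one_mul, hsum2, hsum (k + 1) (by lia)]
    simp only [C_sub, sub_mul, Finset.sum_sub_distrib]
    ring
  rw [mul_assoc, hXP, hsum (k + 2) (by lia), hsum k (by lia), mul_add, mul_add, mul_add,
    Finset.mul_sum, Finset.mul_sum, Finset.mul_sum]
  have hcombine : ∑ j ∈ Finset.range (k + 3), C ((k : ℝ) + (2 * c + 1) - 1) *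
      (C (jacobiCoeff (c - 1) (c - 1) (k + 2) (j + 1)) * (u ^ j * u)) =
      ∑ j ∈ Finset.range (k + 3), C (2 * (k : ℝ) + (2 * c + 1)) *
        (C (jacobiCoeff (c - 1) (c - 1) (k + 1) (j + 1)
          - 2 * jacobiCoeff (c - 1) (c - 1) (k + 1) j) * (u ^ j * u)) -
      ∑ j ∈ Finset.range (k + 3), C ((k : ℝ) + 1) *
        (C (jacobiCoeff (c - 1) (c - 1) k (j + 1)) * (u ^ j * u)) := by
    rw [← Finset.sum_sub_distrib]
    refine Finset.sum_congr rfl fun j _ => ?_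
    have e (x y : ℝ) (z : ℝ[X]) : C x * (C y * z) = C (x * y) * z := by rw [C_mul, mul_assoc]
    rw [e, e, e, ← sub_mul, ← C_sub]
    congr 2
    linear_combination jacobiCoeff_recurrence hc k j
  have hconst : (C ((k : ℝ) + (2 * c + 1) - 1) : ℝ[X]) * 1 =
      C (2 * (k : ℝ) + (2 * c + 1)) * 1 - C ((k : ℝ) + 1) * 1 := by
    simp only [mul_one, ← C_sub]
    congr 1; ring
  rw [hcombine, hconst]
  ring

/-- The recurrence at -1 closes up because (2k + n) - (k + 1) = k + n - 1. -/
theorem gegenbauerPoly_eval_neg_one_succ {n : ℕ} (hn : 2 ≤ n) (k : ℕ) :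
    (gegenbauerPoly n (k + 1)).eval (-1) = -(gegenbauerPoly n k).eval (-1) := by
  have hn' : (2 : ℝ) ≤ n := by exact_mod_cast hn
  induction k with
  | zero => simp [gegenbauerPoly_zero, gegenbauerPoly_one hn]
  | succ k ih =>
    have h := congr_arg (eval (-1)) (gegenbauerPoly_recurrence hn k)
    simp only [eval_mul, eval_sub, eval_C, eval_X] at h
    have hpos : (k : ℝ) + n - 1 ≠ 0 := by
      have : (0 : ℝ) < (k : ℝ) + n - 1 := by have := k.cast_nonneg (α := ℝ); linarith
      exact this.ne'
    apply mul_left_cancel₀ hpos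
    linear_combination h - ((k : ℝ) + 1) * ih

theorem gegenbauerPoly_eval_neg_one_ne_zero {n : ℕ} (hn : 2 ≤ n) (k : ℕ) :
    (gegenbauerPoly n k).eval (-1) ≠ 0 := by
  induction k with
  | zero => simp [gegenbauerPoly_zero]
  | succ k ih => rwa [gegenbauerPoly_eval_neg_one_succ hn, neg_ne_zero]

/-! ### The kernel of evaluation at 1. -/

/-- The kernel `∑_{i ≤ k} r_i P_i^{(n)}`, which represents evaluation at `1` on the polynomials
of degree at most `k`. -/
noncomputable def gegenbauerKernelOne (n : ℕ) : ℕ → ℝ[X]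
  | 0 => 1
  | k + 1 => gegenbauerKernelOne n k +
      C (((k + 1 + (n - 2)).choose (n - 2) : ℝ) + ((k + (n - 2)).choose (n - 2) : ℝ)) *
        gegenbauerPoly n (k + 1)

theorem cast_succ_mul_choose_succ_add (k v : ℕ) :
    ((k : ℝ) + 1) * ((k + 1 + v).choose v : ℝ) = (k + 1 + v) * ((k + v).choose v : ℝ) := by
  have h := Nat.add_one_mul_choose_eq (k + v) k
  rw [Nat.choose_symm_add, show (k + v).succ.choose k.succ = (k + 1 + v).choose v by
    rw [show (k + v).succ = k.succ + v by lia, Nat.choose_symm_add]] at h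
  have h' : (((k + v).succ * (k + v).choose v : ℕ) : ℝ) = ((k + 1 + v).choose v * k.succ : ℕ) := by
    rw [h]
  push_cast at h'
  linear_combination -h'

/-- The Christoffel-Darboux formula at 1. The coefficients of the kernel are the dimensions of the
spaces of harmonic polynomials, and the sum telescopes by the three-term recurrence. -/
theorem one_sub_X_mul_gegenbauerKernelOne {n : ℕ} (hn : 2 ≤ n) (k : ℕ) :
    (1 - X) * gegenbauerKernelOne n k =
      C ((k + (n - 2)).choose (n - 2) : ℝ) * (gegenbauerPoly n k - gegenbauerPoly n (k + 1)) := by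
  induction k with
  | zero => simp [gegenbauerKernelOne, gegenbauerPoly_zero, gegenbauerPoly_one hn]
  | succ k ih =>
    obtain ⟨v, rfl⟩ := Nat.exists_eq_add_of_le' hn
    simp only [Nat.add_sub_cancel] at ih ⊢
    have hch := cast_succ_mul_choose_succ_add k v
    rw [gegenbauerKernelOne, mul_add, ih]
    simp only [Nat.add_sub_cancel]
    have hrec := gegenbauerPoly_recurrence hn k
    have hk : ((k : ℝ) + 1) ≠ 0 := by positivity
    have hk' : (C ((k : ℝ) + 1) : ℝ[X]) ≠ 0 := by rwa [Ne, C_eq_zero]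
    have hch' := congr_arg (C : ℝ → ℝ[X]) hch
    push_cast at hrec hch' ⊢
    apply mul_left_cancel₀ hk'
    simp only [C_add, C_sub, C_mul, C_1, C_ofNat, map_natCast] at hrec hch' ⊢
    linear_combination (gegenbauerPoly (v + 2) (k + 2) - X * gegenbauerPoly (v + 2) (k + 1)) * hch'
      + ((k + v).choose v : ℝ[X]) * hrec

theorem gegenbauerKernelOne_eval_one {n : ℕ} (hn : 2 ≤ n) (k : ℕ) :
    (gegenbauerKernelOne n k).eval 1 =
      ((k + (n - 2)).choose (n - 2) : ℝ) * ((2 * (k : ℝ) + n - 1) / ((n : ℝ) - 1)) := by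
  have hn' : (2 : ℝ) ≤ n := by exact_mod_cast hn
  have hp : (n : ℝ) - 1 ≠ 0 := by
    have : 0 < (n : ℝ) - 1 := by linarith
    exact this.ne'
  induction k with
  | zero => simp [gegenbauerKernelOne, hp]
  | succ k ih =>
    obtain ⟨v, rfl⟩ := Nat.exists_eq_add_of_le' hn
    have hch := cast_succ_mul_choose_succ_add k v
    have hk : ((k : ℝ) + 1) ≠ 0 := by positivity
    rw [gegenbauerKernelOne, eval_add, ih, eval_mul, eval_C, gegenbauerPoly_eval_one]
    simp only [Nat.add_sub_cancel]
    have hch2 : ((k + 1 + v).choose v : ℝ) = (k + 1 + v) * ((k + v).choose v : ℝ) / (k + 1) := by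
      rw [eq_div_iff hk]; linear_combination hch
    rw [hch2]
    push_cast at hp ⊢
    have hv : (v : ℝ) + 2 - 1 ≠ 0 := hp
    field_simp
    ring

theorem gegenbauerKernelOne_degree_lt {n : ℕ} (hn : 2 ≤ n) (k : ℕ) :
    (gegenbauerKernelOne n k).degree < (k + 1 : ℕ) := by
  induction k with
  | zero => rw [gegenbauerKernelOne, degree_one]; norm_num
  | succ k ih =>
    rw [gegenbauerKernelOne]
    refine (degree_add_le _ _).trans_lt (max_lt (ih.trans (by norm_cast; lia)) ?_)
    rw [← smul_eq_C_mul]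
    refine (degree_smul_le _ _).trans_lt ?_
    rw [gegenbauerPoly_degree hn]
    norm_cast; lia

theorem gegenbauerMean_gegenbauerPoly_succ {n : ℕ} (hn : 2 ≤ n) (k : ℕ) :
    gegenbauerMean hn (gegenbauerPoly n (k + 1)) = 0 := by
  have := gegenbauerMean_gegenbauerPoly_mul hn (k := k + 1) (q := 1)
    (by rw [degree_one]; exact_mod_cast k.succ_pos)
  rwa [mul_one] at this

theorem gegenbauerMean_gegenbauerKernelOne {n : ℕ} (hn : 2 ≤ n) (k : ℕ) :
    gegenbauerMean hn (gegenbauerKernelOne n k) = 1 := by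
  induction k with
  | zero => exact gegenbauerMean_one hn
  | succ k ih =>
    rw [gegenbauerKernelOne, map_add, ih, gegenbauerMean_C_mul,
      gegenbauerMean_gegenbauerPoly_succ, mul_zero, add_zero]

/-- Division by `X - a` lowers the degree. -/
theorem exists_eq_C_add_X_sub_C_mul (q : ℝ[X]) (a : ℝ) {k : ℕ} (hq : q.degree < (k + 1 : ℕ)) :
    ∃ r : ℝ[X], q = C (q.eval a) + (X - C a) * r ∧ r.degree < k := by
  refine ⟨q /ₘ (X - C a), ?_, ?_⟩
  · have := modByMonic_add_div q (X - C a)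
    rw [modByMonic_X_sub_C_eq_C_eval] at this
    exact this.symm
  · rcases eq_or_ne q 0 with rfl | h0
    · rw [zero_divByMonic, degree_zero]; exact WithBot.bot_lt_coe k
    · have h1 : q.natDegree < k + 1 := (natDegree_lt_iff_degree_lt h0).2 hq
      have h2 := natDegree_divByMonic q (monic_X_sub_C a)
      rw [natDegree_X_sub_C] at h2
      rcases eq_or_ne (q /ₘ (X - C a)) 0 with h3 | h3
      · rw [h3, degree_zero]; exact WithBot.bot_lt_coe k
      · rw [← natDegree_lt_iff_degree_lt h3, h2]
        rcases Nat.eq_zero_or_pos q.natDegree with h4 | h4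
        · exfalso
          apply h3
          rw [eq_C_of_natDegree_eq_zero h4]
          exact (divByMonic_eq_zero_iff (monic_X_sub_C a)).2
            (degree_C_le.trans_lt (by rw [degree_X_sub_C]; norm_num))
        · lia

/-- Write q = q(1) + (X - 1)r. By Christoffel-Darboux the second part contributes only P_k r and
P_{k+1} r with deg r < k, whose means vanish. -/
theorem gegenbauerMean_gegenbauerKernelOne_mul {n : ℕ} (hn : 2 ≤ n) {k : ℕ} {q : ℝ[X]}
    (hq : q.degree < (k + 1 : ℕ)) :
    gegenbauerMean hn (gegenbauerKernelOne n k * q) = q.eval 1 := by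
  obtain ⟨r, hr, hrd⟩ := exists_eq_C_add_X_sub_C_mul q 1 hq
  have h1 : gegenbauerKernelOne n k * q = C (q.eval 1) * gegenbauerKernelOne n k
      + C (-((k + (n - 2)).choose (n - 2) : ℝ)) * (gegenbauerPoly n k * r)
      + C ((k + (n - 2)).choose (n - 2) : ℝ) * (gegenbauerPoly n (k + 1) * r) := by
    have h2 := one_sub_X_mul_gegenbauerKernelOne hn k
    conv_lhs => rw [hr]
    rw [C_neg]
    linear_combination (norm := (simp only [C_1]; ring)) -r * h2
  rw [h1, map_add, map_add, gegenbauerMean_C_mul, gegenbauerMean_C_mul, gegenbauerMean_C_mul,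
    gegenbauerMean_gegenbauerKernelOne, gegenbauerMean_gegenbauerPoly_mul hn hrd,
    gegenbauerMean_gegenbauerPoly_mul hn (hrd.trans (by norm_cast; lia))]
  ring

/-! ### The bounds L and D in terms of the kernel at 1. -/

theorem gegenbauerKernelOne_eval_mul {n : ℕ} (hn : 2 ≤ n) (m : ℕ) (s : ℝ) :
    (1 - s) * (gegenbauerKernelOne n m).eval s = ((m + (n - 2)).choose (n - 2) : ℝ) *
      ((gegenbauerPoly n m).eval s - (gegenbauerPoly n (m + 1)).eval s) := by
  simpa using congr_arg (eval s) (one_sub_X_mul_gegenbauerKernelOne hn m)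

/-- Here and below m = k - 1 + ε is the degree of the kernel at 1. In this form L compares directly
with D(n, τ), which is T(1) for ε = 1 and exceeds T(1) by one binomial for ε = 0, where T is that
kernel. -/
theorem levenshteinBound_eq {n k ε m : ℕ} (hn : 2 ≤ n) (hk : 1 ≤ k) (hm : k + ε = m + 1) {s : ℝ}
    (hs : s < 1) : levenshteinBound n k ε s = (gegenbauerKernelOne n m).eval 1 -
      (1 + s) ^ ε * (gegenbauerKernelOne n m).eval s /
        (ε * (gegenbauerPoly n k).eval s + (gegenbauerPoly n (m + 1)).eval s) := by
  have h1 : k - 1 + ε = m := by lia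
  have h2 : k + n - 3 + ε = m + (n - 2) := by lia
  have h3 : (m : ℝ) = k + ε - 1 := by
    have : (k : ℝ) + ε = m + 1 := by exact_mod_cast hm
    linarith
  have hs' : 1 - s ≠ 0 := by
    have : 0 < 1 - s := by linarith
    exact this.ne'
  rw [levenshteinBound, h1, h2, hm, gegenbauerKernelOne_eval_one hn, mul_sub,
    show 2 * (m : ℝ) + n - 1 = 2 * (k : ℝ) + n - 3 + 2 * ε by rw [h3]; ring]
  congr 1
  have h4 := gegenbauerKernelOne_eval_mul hn m s
  have h5 : (gegenbauerKernelOne n m).eval s = ((m + (n - 2)).choose (n - 2) : ℝ) *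
      ((gegenbauerPoly n m).eval s - (gegenbauerPoly n (m + 1)).eval s) / (1 - s) := by
    rw [eq_div_iff hs', ← h4, mul_comm]
  rw [h5]
  generalize (ε : ℝ) * (gegenbauerPoly n k).eval s + (gegenbauerPoly n (m + 1)).eval s = E
  generalize 1 - s = d
  ring

theorem dgsBound_eq {n k ε m τ : ℕ} (hn : 2 ≤ n) (hk : 1 ≤ k) (hε : ε ≤ 1) (hm : k + ε = m + 1)
    (hτ : τ = 2 * k - 1 + ε) : (dgsBound n τ : ℝ) =
      (gegenbauerKernelOne n m).eval 1 + (1 - ε) * ((m + (n - 2)).choose (n - 2) : ℝ) := by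
  have h1 : (τ + 1) / 2 = k := by lia
  have h2 : (τ + 1) % 2 = ε := by lia
  rw [dgsBound, h1, h2, gegenbauerKernelOne_eval_one hn]
  obtain ⟨v, rfl⟩ := Nat.exists_eq_add_of_le' hn
  have hstep (i : ℕ) : ((v : ℝ) + 1) * ((i + v + 1).choose (v + 1) : ℝ) =
      (i + v + 1) * ((i + v).choose v : ℝ) := by
    have h : (((i + v + 1) * (i + v).choose v : ℕ) : ℝ) =
      ((i + v + 1).choose (v + 1) * (v + 1) : ℕ) := by rw [Nat.add_one_mul_choose_eq]
    push_cast at h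
    linear_combination -h
  have hstep2 (i : ℕ) : ((v : ℝ) + 1) * ((i + v).choose (v + 1) : ℝ) =
      i * ((i + v).choose v : ℝ) := by
    have h : (((i + v).choose (v + 1) * (v + 1) : ℕ) : ℝ) = ((i + v).choose v * (i + v - v) : ℕ) := by
      rw [Nat.choose_succ_right_eq]
    rw [Nat.add_sub_cancel] at h
    push_cast at h
    linear_combination h
  have hv : (v : ℝ) + 1 ≠ 0 := by positivity
  have hv2 : ((v + 2 : ℕ) : ℝ) - 1 = v + 1 := by push_cast; ring
  simp only [Nat.add_sub_cancel]
  rw [hv2]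
  apply mul_left_cancel₀ hv
  obtain rfl | rfl : ε = 0 ∨ ε = 1 := by lia
  · obtain rfl : k = m + 1 := by lia
    rw [show v + 2 + (m + 1) - 2 + 0 = m + v + 1 by lia,
      show v + 2 + (m + 1) - 2 = m + v + 1 by lia, show v + 2 - 1 = v + 1 by lia]
    push_cast
    field_simp
    linear_combination 2 * hstep m
  · obtain rfl : k = m := by lia
    rw [show v + 2 + k - 2 + 1 = k + v + 1 by lia,
      show v + 2 + k - 2 = k + v by lia, show v + 2 - 1 = v + 1 by lia]
    push_cast
    field_simp
    linear_combination hstep k + hstep2 k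

/-! ### The Christoffel-Darboux kernel and the nodal polynomial. -/

/-- Leading terms are stripped off until the remainder has degree below k; it is then orthogonal to
itself, so zero. -/
theorem exists_eq_sum_gegenbauerPoly {n : ℕ} (hn : 2 ≤ n) (k j : ℕ) {R : ℝ[X]}
    (hR : R.degree < (k + j : ℕ)) (h0 : ∀ q : ℝ[X], q.degree < k → gegenbauerMean hn (R * q) = 0) :
    ∃ a : ℕ → ℝ, R = ∑ i ∈ Finset.range j, C (a i) * gegenbauerPoly n (k + i) := by
  induction j generalizing R with
  | zero =>
    refine ⟨0, ?_⟩
    by_contra hne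
    have h1 := h0 R hR
    have h2 := gegenbauerMean_pos hn (f := R * R)
      (fun t _ => by rw [eval_mul]; exact mul_self_nonneg _)
      (mul_self_ne_zero.2 (by simpa using hne))
    exact h2.ne' h1
  | succ j ih =>
    obtain ⟨b, hb⟩ := exists_degree_sub_C_mul_lt hR (gegenbauerPoly_degree hn (k + j))
    obtain ⟨a, ha⟩ := ih hb fun q hq => by
      rw [sub_mul, map_sub, h0 q hq, mul_assoc, gegenbauerMean_C_mul,
        gegenbauerMean_gegenbauerPoly_mul hn (hq.trans_le (by norm_cast; lia)), mul_zero, sub_zero]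
    refine ⟨fun i => if i = j then b else a i, ?_⟩
    simp only [Finset.sum_range_succ, if_true]
    rw [← sub_eq_iff_eq_add, ha]
    refine Finset.sum_congr rfl fun i hi => ?_
    rw [if_neg (Finset.mem_range.1 hi).ne]

theorem adjacentPoly_degree {n : ℕ} (hn : 2 ≤ n) (ε i : ℕ) : (adjacentPoly n ε i).degree = i := by
  have hn' : (2 : ℝ) ≤ n := by exact_mod_cast hn
  have := ε.cast_nonneg (α := ℝ)
  exact jacobiPoly_degree (by linarith) (by linarith) i

theorem gegenbauerMean_adjacentPoly_mul {n : ℕ} (hn : 2 ≤ n) (ε : ℕ) {i : ℕ} {q : ℝ[X]}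
    (hq : q.degree < i) :
    gegenbauerMean hn (adjacentPoly n ε i * q * ((1 - X) * (1 + X) ^ ε)) = 0 := by
  have h := gegenbauerMean_jacobiPoly_mul hn 1 ε hq
  rw [mul_right_comm]
  simpa [adjacentPoly] using h

theorem gegenbauerMean_adjacentPoly_sq_pos {n : ℕ} (hn : 2 ≤ n) (ε i : ℕ) :
    0 < gegenbauerMean hn (adjacentPoly n ε i * adjacentPoly n ε i * ((1 - X) * (1 + X) ^ ε)) := by
  refine gegenbauerMean_pos hn (fun t ht => ?_) ?_
  · have h1 : 0 ≤ 1 - t := by linarith [ht.2]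
    have h2 : 0 ≤ 1 + t := by linarith [ht.1]
    simp only [eval_mul, eval_sub, eval_add, eval_one, eval_X, eval_pow]
    exact mul_nonneg (mul_self_nonneg _) (by positivity)
  · have h1 : adjacentPoly n ε i ≠ 0 := by
      intro h
      have := adjacentPoly_degree hn ε i
      rw [h] at this
      simp at this
    have h2 : (1 - X : ℝ[X]) ≠ 0 := by
      intro h
      have := congr_arg (eval 0) h
      simp at this
    have h3 : (1 + X : ℝ[X]) ≠ 0 := by
      intro h
      have := congr_arg (eval 0) h
      simp at this
    exact mul_ne_zero (mul_self_ne_zero.2 h1) (mul_ne_zero h2 (pow_ne_zero _ h3))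

theorem levenshteinKernel_eq {n : ℕ} (hn : 2 ≤ n) (k ε : ℕ) (s : ℝ) : levenshteinKernel n k ε s =
    ∑ i ∈ Finset.range k, C ((adjacentPoly n ε i).eval s / gegenbauerMean hn
      (adjacentPoly n ε i * adjacentPoly n ε i * ((1 - X) * (1 + X) ^ ε))) * adjacentPoly n ε i := by
  refine Finset.sum_congr rfl fun i _ => ?_
  congr 3
  rw [gegenbauerMean_apply, gegenbauerCoeffZero]
  congr 1
  ext t
  simp only [eval_mul, eval_sub, eval_add, eval_one, eval_X, eval_pow]
  ring

theorem levenshteinKernel_degree_lt {n : ℕ} (hn : 2 ≤ n) (k ε : ℕ) (s : ℝ) :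
    (levenshteinKernel n k ε s).degree < k := by
  rw [levenshteinKernel_eq hn, ← mem_degreeLT]
  refine Submodule.sum_mem _ fun i hi => ?_
  rw [mem_degreeLT, ← smul_eq_C_mul]
  refine (degree_smul_le _ _).trans_lt ?_
  rw [adjacentPoly_degree hn]
  simpa using hi

/-- The reproducing property of the Christoffel-Darboux kernel. -/
theorem gegenbauerMean_levenshteinKernel_mul {n : ℕ} (hn : 2 ≤ n) (k ε : ℕ) (s : ℝ) {q : ℝ[X]}
    (hq : q.degree < k) :
    gegenbauerMean hn (levenshteinKernel n k ε s * q * ((1 - X) * (1 + X) ^ ε)) = q.eval s := by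
  obtain ⟨w, hw⟩ : ∃ w : ℝ[X], w = (1 - X) * (1 + X) ^ ε := ⟨_, rfl⟩
  have horth (i j : ℕ) (hij : j < i) :
      gegenbauerMean hn (adjacentPoly n ε i * adjacentPoly n ε j * w) = 0 :=
    hw ▸ gegenbauerMean_adjacentPoly_mul hn ε
      (by rw [adjacentPoly_degree hn]; exact_mod_cast hij)
  have hpos (i : ℕ) : 0 < gegenbauerMean hn (adjacentPoly n ε i * adjacentPoly n ε i * w) :=
    hw ▸ gegenbauerMean_adjacentPoly_sq_pos hn ε i
  have hK := levenshteinKernel_eq hn k ε s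
  rw [← hw] at hK ⊢
  have h := linearMap_eq_zero_of_degree_lt
    (gegenbauerMean hn ∘ₗ LinearMap.mulRight ℝ w ∘ₗ
      LinearMap.mulLeft ℝ (levenshteinKernel n k ε s) - leval s)
    (adjacentPoly n ε) (adjacentPoly_degree hn ε) (k := k) ?_ hq
  · simpa [sub_eq_zero] using h
  intro j hj
  simp only [LinearMap.sub_apply, LinearMap.comp_apply, LinearMap.mulLeft_apply,
    LinearMap.mulRight_apply, leval_apply, sub_eq_zero]
  rw [hK, Finset.sum_mul, Finset.sum_mul, map_sum,
    Finset.sum_eq_single_of_mem j (Finset.mem_range.2 hj)]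
  · rw [mul_assoc, mul_assoc, gegenbauerMean_C_mul, ← mul_assoc (adjacentPoly n ε j),
      div_mul_cancel₀ _ (hpos j).ne']
  · intro i _ hij
    rw [mul_assoc, mul_assoc, gegenbauerMean_C_mul, ← mul_assoc (adjacentPoly n ε i)]
    rcases lt_or_gt_of_ne hij with h1 | h1
    · rw [mul_comm (adjacentPoly n ε i) (adjacentPoly n ε j), horth j i h1, mul_zero]
    · rw [horth i j h1, mul_zero]

theorem degree_X_sub_C_mul_lt {q : ℝ[X]} {j : ℕ} (a : ℝ) (hq : q.degree < j) :
    ((X - C a) * q).degree < ((j + 1 : ℕ) : WithBot ℕ) := by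
  rcases eq_or_ne q 0 with rfl | h0
  · rw [mul_zero, degree_zero]; exact WithBot.bot_lt_coe _
  · rw [degree_mul, degree_X_sub_C, degree_eq_natDegree h0, ← Nat.cast_one (R := WithBot ℕ),
      ← Nat.cast_add, Nat.cast_lt]
    rw [degree_eq_natDegree h0, Nat.cast_lt] at hq
    lia

/-- The product of the linear factors at the nodes, up to a constant factor. -/
noncomputable def levenshteinNodal (n k ε : ℕ) (s : ℝ) : ℝ[X] :=
  (X - C s) * (X + 1) ^ ε * levenshteinKernel n k ε s

/-- The kernel reproduces the value of (X - s)q at s, which is 0. -/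
theorem gegenbauerMean_levenshteinNodal_mul_one_sub_X {n : ℕ} (hn : 2 ≤ n) (k ε : ℕ) (s : ℝ)
    {q : ℝ[X]} (hq : q.degree < k) :
    gegenbauerMean hn (levenshteinNodal n (k + 1) ε s * ((1 - X) * q)) = 0 := by
  have h := gegenbauerMean_levenshteinKernel_mul hn (k + 1) ε s (degree_X_sub_C_mul_lt s hq)
  rw [eval_mul, eval_sub, eval_X, eval_C, sub_self, zero_mul] at h
  rw [← h, levenshteinNodal]
  congr 1
  ring

theorem gegenbauerMean_levenshteinNodal_mul {n : ℕ} (hn : 2 ≤ n) (k ε : ℕ) (s : ℝ)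
    {q : ℝ[X]} (hq : q.degree < (k + 1 : ℕ)) :
    gegenbauerMean hn (levenshteinNodal n (k + 1) ε s * q) =
      gegenbauerMean hn (levenshteinNodal n (k + 1) ε s) * q.eval 1 := by
  obtain ⟨r, hr, hrd⟩ := exists_eq_C_add_X_sub_C_mul q 1 hq
  have h1 : levenshteinNodal n (k + 1) ε s * q = C (q.eval 1) * levenshteinNodal n (k + 1) ε s
      + C (-1) * (levenshteinNodal n (k + 1) ε s * ((1 - X) * r)) := by
    conv_lhs => rw [hr]
    rw [C_neg, C_1]
    ring
  rw [h1, map_add, gegenbauerMean_C_mul, gegenbauerMean_C_mul,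
    gegenbauerMean_levenshteinNodal_mul_one_sub_X hn k ε s hrd]
  ring

theorem degree_levenshteinNodal_lt {n : ℕ} (hn : 2 ≤ n) (k : ℕ) {ε : ℕ} (hε : ε ≤ 1) (s : ℝ) :
    (levenshteinNodal n k ε s).degree < (k + (ε + 1) : ℕ) := by
  have h := levenshteinKernel_degree_lt hn k ε s
  obtain rfl | rfl : ε = 0 ∨ ε = 1 := by lia
  · rw [levenshteinNodal, pow_zero, mul_one]
    exact degree_X_sub_C_mul_lt s h
  · have h2 := degree_X_sub_C_mul_lt s (degree_X_sub_C_mul_lt (-1) h)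
    rw [levenshteinNodal, pow_one, mul_assoc]
    rwa [C_neg, C_1, sub_neg_eq_add] at h2

/-- The quadrature formula at the nodal polynomial, where it defines the Levenshtein bound. -/
theorem gegenbauerMean_levenshteinNodal_mul_levenshteinBound {n k ε m : ℕ} (hn : 2 ≤ n)
    (hk : 1 ≤ k) (hε : ε ≤ 1) (hm : k + ε = m + 1) {s : ℝ} (hs : s < 1)
    (hden : ε * (gegenbauerPoly n k).eval s + (gegenbauerPoly n (m + 1)).eval s ≠ 0) :
    gegenbauerMean hn (levenshteinNodal n k ε s) * levenshteinBound n k ε s =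
      (levenshteinNodal n k ε s).eval 1 := by
  obtain ⟨κ, rfl⟩ := Nat.exists_eq_add_of_le' hk
  set F := levenshteinNodal n (κ + 1) ε s with hF
  set M := gegenbauerMean hn F with hM
  have hdegF : F.degree < ((κ + 1) + (ε + 1) : ℕ) := degree_levenshteinNodal_lt hn _ hε s
  have hdegT : (C M * gegenbauerKernelOne n m).degree < ((κ + 1) + (ε + 1) : ℕ) := by
    rw [← smul_eq_C_mul]
    refine ((degree_smul_le _ _).trans_lt (gegenbauerKernelOne_degree_lt hn m)).trans_le ?_
    norm_cast; lia
  -- Both F and M times the kernel at 1 represent q ↦ M q(1) in degree below k, so their difference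
  -- has only ε + 1 Gegenbauer terms. The zeros of F at s and, for ε = 1, at -1 supply the equations
  -- for their coefficients.
  obtain ⟨a, ha⟩ := exists_eq_sum_gegenbauerPoly hn (κ + 1) (ε + 1) (R := F - C M * gegenbauerKernelOne n m)
    ((degree_sub_le _ _).trans_lt (max_lt hdegF hdegT)) fun q hq => by
      rw [sub_mul, map_sub, mul_assoc, gegenbauerMean_C_mul,
        gegenbauerMean_gegenbauerKernelOne_mul hn (hq.trans_le (by norm_cast; lia)),
        gegenbauerMean_levenshteinNodal_mul hn κ ε s hq, sub_self]
  have h1 := congr_arg (eval 1) ha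
  have h2 := congr_arg (eval s) ha
  have h3 := congr_arg (eval (-1)) ha
  have hFs : F.eval s = 0 := by rw [hF, levenshteinNodal]; simp
  have hker := gegenbauerKernelOne_eval_mul hn m s
  have hker1 := gegenbauerKernelOne_eval_mul hn m (-1)
  rw [levenshteinBound_eq hn hk hm hs]
  obtain rfl | rfl : ε = 0 ∨ ε = 1 := by lia
  · obtain rfl : κ = m := by lia
    rw [zero_add, Finset.sum_range_one, add_zero] at h1 h2
    simp only [eval_sub, eval_mul, eval_C, gegenbauerPoly_eval_one, hFs] at h1 h2
    simp only [Nat.cast_zero, zero_mul, zero_add, pow_zero, one_mul] at hden ⊢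
    have ha0 : a 0 = -(M * (gegenbauerKernelOne n κ).eval s) / (gegenbauerPoly n (κ + 1)).eval s := by
      rw [eq_div_iff hden]; linarith
    rw [ha0] at h1
    rw [sub_eq_iff_eq_add.1 h1]
    ring
  · obtain rfl : m = κ + 1 := by lia
    have hFm : F.eval (-1) = 0 := by rw [hF, levenshteinNodal]; simp
    rw [Finset.sum_range_succ, Finset.sum_range_one, add_zero] at h1 h2 h3
    simp only [eval_sub, eval_add, eval_mul, eval_C, gegenbauerPoly_eval_one, hFs, hFm] at h1 h2 h3
    rw [gegenbauerPoly_eval_neg_one_succ hn (κ + 1)] at h3 hker1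
    have hne := gegenbauerPoly_eval_neg_one_ne_zero hn (κ + 1)
    set c : ℝ := ((κ + 1 + (n - 2)).choose (n - 2) : ℝ)
    set p := (gegenbauerPoly n (κ + 1)).eval (-1)
    have hT1 : (gegenbauerKernelOne n (κ + 1)).eval (-1) = c * p := by linarith
    rw [hT1] at h3
    have ha1 : a 1 = a 0 + M * c := by
      apply mul_right_cancel₀ hne
      linear_combination h3
    rw [ha1] at h1 h2
    simp only [Nat.cast_one, one_mul, pow_one] at hden ⊢
    set T := (gegenbauerKernelOne n (κ + 1)).eval s
    set A := (gegenbauerPoly n (κ + 1)).eval s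
    set B := (gegenbauerPoly n (κ + 1 + 1)).eval s
    field_simp
    linear_combination (-(A + B)) * h1 + 2 * h2 + M * hker

/-! ### Strict positivity of (s - t)(1 - t) against squares. -/

theorem degree_mul_lt_add {p q : ℝ[X]} {a b : ℕ} (hp : p.degree < (a + 1 : ℕ)) (hq : q.degree < b) :
    (p * q).degree < ((a + b : ℕ) : WithBot ℕ) := by
  rcases eq_or_ne p 0 with rfl | hp0
  · rw [zero_mul, degree_zero]; exact WithBot.bot_lt_coe _
  rcases eq_or_ne q 0 with rfl | hq0
  · rw [mul_zero, degree_zero]; exact WithBot.bot_lt_coe _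
  rw [degree_eq_natDegree hp0, Nat.cast_lt] at hp
  rw [degree_eq_natDegree hq0, Nat.cast_lt] at hq
  rw [degree_mul, degree_eq_natDegree hp0, degree_eq_natDegree hq0, ← Nat.cast_add, Nat.cast_lt]
  lia

theorem degree_one_add_X_pow_lt (j : ℕ) : ((1 + X : ℝ[X]) ^ j).degree < ((j + 1 : ℕ) : WithBot ℕ) := by
  rw [degree_one_add_X_pow]; norm_cast; lia

/-- Nonnegativity of the functional `u ↦ ∫ (s - t) (1 - t) u(t) dμ_n(t)` on the polynomials of
degree less than `d` that are nonnegative on `[-1, 1]`. -/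
def NonnegBelow {n : ℕ} (hn : 2 ≤ n) (s : ℝ) (d : ℕ) : Prop :=
  ∀ u : ℝ[X], u.degree < d → (∀ t ∈ Set.Icc (-1 : ℝ) 1, 0 ≤ u.eval t) →
    0 ≤ gegenbauerMean hn ((C s - X) * (1 - X) * u)

theorem denominator_ne_zero {n k ε m : ℕ} (hn : 2 ≤ n) (hk : 1 ≤ k) (hε : ε ≤ 1)
    (hm : k + ε = m + 1) {s : ℝ} (hs : s < 1)
    (hlow : (gegenbauerKernelOne n m).eval 1 + (1 - ε) * ((m + (n - 2)).choose (n - 2) : ℝ) <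
      levenshteinBound n k ε s) :
    ε * (gegenbauerPoly n k).eval s + (gegenbauerPoly n (m + 1)).eval s ≠ 0 := by
  intro h0
  -- With a zero denominator the quotient takes the default value 0, so L would be T(1) ≤ D(n, τ), T
  -- the kernel at 1.
  rw [levenshteinBound_eq hn hk hm hs, h0, div_zero, sub_zero] at hlow
  have h1 : (0 : ℝ) ≤ 1 - ε := by
    have : (ε : ℝ) ≤ 1 := by exact_mod_cast hε
    linarith
  have h2 : (0 : ℝ) ≤ ((m + (n - 2)).choose (n - 2) : ℝ) := Nat.cast_nonneg _
  nlinarith [mul_nonneg h1 h2]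

/-- If `(s - t) (1 - t) (1 + t) ^ (1 - ε) q` is orthogonal to all polynomials of degree less
than `m`, then `s` is a zero of the orthogonal polynomial at which the Levenshtein bound takes
its smallest admissible value. -/
theorem levenshteinBound_le_of_orthogonal {n k ε m : ℕ} (hn : 2 ≤ n) (hk : 1 ≤ k) (hε : ε ≤ 1)
    (hm : k + ε = m + 1) {s : ℝ} (hs : s < 1) {q : ℝ[X]} (hq0 : q ≠ 0) (hq : q.degree < m)
    (horth : ∀ r : ℝ[X], r.degree < m →
      gegenbauerMean hn ((C s - X) * (1 - X) * ((1 + X) ^ (1 - ε) * q) * r) = 0) :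
    levenshteinBound n k ε s ≤
      (gegenbauerKernelOne n m).eval 1 + (1 - ε) * ((m + (n - 2)).choose (n - 2) : ℝ) := by
  by_contra! hlow
  have hden := denominator_ne_zero hn hk hε hm hs hlow
  have hn' : (2 : ℝ) ≤ n := by exact_mod_cast hn
  set G : ℝ[X] := (C s - X) * (1 - X) * ((1 + X) ^ (1 - ε) * q) with hG
  have hG0 : G ≠ 0 := by
    refine mul_ne_zero (mul_ne_zero ?_ ?_) (mul_ne_zero (pow_ne_zero _ ?_) hq0)
    · rw [← neg_sub]; exact neg_ne_zero.2 (X_sub_C_ne_zero s)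
    · rw [← neg_sub, ← C_1]; exact neg_ne_zero.2 (X_sub_C_ne_zero 1)
    · rw [add_comm, ← C_1]; exact X_add_C_ne_zero 1
  have hGd : G.degree < (m + (3 - ε) : ℕ) := by
    have h1 := degree_X_sub_C_mul_lt s (degree_X_sub_C_mul_lt 1
      (degree_mul_lt_add (degree_one_add_X_pow_lt (1 - ε)) hq))
    have h2 : G = (X - C s) * ((X - C 1) * ((1 + X) ^ (1 - ε) * q)) := by rw [hG, C_1]; ring
    rw [h2]
    refine h1.trans_le ?_
    norm_cast; lia
  -- Three Gegenbauer terms remain for ε = 0, two for ε = 1. The zeros at 1 and, for ε = 0, at -1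
  -- fix them up to a factor as P_{m+2} - P_m, respectively P_{m+1} - P_m; the zero at s then
  -- determines the value of L.
  obtain ⟨a, ha⟩ := exists_eq_sum_gegenbauerPoly hn m (3 - ε) hGd horth
  have e1 : G.eval 1 = 0 := by rw [hG]; simp
  have es : G.eval s = 0 := by rw [hG]; simp
  have hs' : 1 - s ≠ 0 := by
    have : 0 < 1 - s := by linarith
    exact this.ne'
  have hker := gegenbauerKernelOne_eval_mul hn m s
  rw [levenshteinBound_eq hn hk hm hs] at hlow
  obtain rfl | rfl : ε = 0 ∨ ε = 1 := by lia
  · have e2 : G.eval (-1) = 0 := by rw [hG]; simp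
    rw [show 3 - 0 = 3 from rfl, Finset.sum_range_succ, Finset.sum_range_succ,
      Finset.sum_range_one, add_zero] at ha
    rw [ha] at e1 e2 es
    simp only [eval_add, eval_mul, eval_C, gegenbauerPoly_eval_one] at e1 e2 es
    rw [gegenbauerPoly_eval_neg_one_succ hn (m + 1), gegenbauerPoly_eval_neg_one_succ hn m] at e2
    have hne := gegenbauerPoly_eval_neg_one_ne_zero hn m
    have a1 : a 1 = 0 := by
      have : (a 0 - a 1 + a 2) * (gegenbauerPoly n m).eval (-1) = 0 := by linear_combination e2
      have := (mul_eq_zero.1 this).resolve_right hne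
      linarith
    have a2 : a 2 = -a 0 := by linarith
    have a0 : a 0 ≠ 0 := by
      intro h
      apply hG0
      rw [ha, a2, a1, h]
      simp
    rw [a1, a2] at es
    have hp : (gegenbauerPoly n (m + 2)).eval s = (gegenbauerPoly n m).eval s := by
      apply mul_left_cancel₀ a0; linear_combination -es
    have hrec := congr_arg (eval s) (gegenbauerPoly_recurrence hn m)
    simp only [eval_sub, eval_mul, eval_C, eval_X, hp] at hrec
    have hpos : (2 * (m : ℝ) + n) ≠ 0 := by positivity
    -- With P_{m+2}(s) = P_m(s) the recurrence becomes a multiple of P_m(s) = s P_{m+1}(s).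
    have hp2 : (gegenbauerPoly n m).eval s = s * (gegenbauerPoly n (m + 1)).eval s := by
      apply mul_left_cancel₀ hpos; linear_combination hrec
    have hT : (gegenbauerKernelOne n m).eval s =
        -(((m + (n - 2)).choose (n - 2) : ℝ) * (gegenbauerPoly n (m + 1)).eval s) := by
      apply mul_left_cancel₀ hs'
      rw [hker, hp2]; ring
    rw [hT] at hlow
    simp only [Nat.cast_zero, zero_mul, zero_add, pow_zero, one_mul, sub_zero] at hlow hden
    rw [neg_div, mul_div_cancel_right₀ _ hden, sub_neg_eq_add] at hlow
    exact lt_irrefl _ hlow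
  · rw [show 3 - 1 = 2 from rfl, Finset.sum_range_succ, Finset.sum_range_one, add_zero] at ha
    rw [ha] at e1 es
    simp only [eval_add, eval_mul, eval_C, gegenbauerPoly_eval_one] at e1 es
    have a1 : a 1 = -a 0 := by linarith
    have a0 : a 0 ≠ 0 := by
      intro h
      apply hG0
      rw [ha, a1, h]
      simp
    rw [a1] at es
    have hT : (gegenbauerKernelOne n m).eval s = 0 := by
      apply mul_left_cancel₀ hs'
      apply mul_left_cancel₀ a0
      rw [hker]
      linear_combination ((m + (n - 2)).choose (n - 2) : ℝ) * es
    rw [hT] at hlow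
    simp at hlow

/-- The form is already nonnegative, so by Cauchy-Schwarz an isotropic `q` would be orthogonal to
everything of degree below m, which the lower bound on L excludes. -/
theorem gegenbauerMean_mul_sq_pos {n k ε m : ℕ} (hn : 2 ≤ n) (hk : 1 ≤ k) (hε : ε ≤ 1)
    (hm : k + ε = m + 1) {s : ℝ} (hs : s < 1) (hΦ : NonnegBelow hn s (2 * k - 2 + ε))
    (hlow : (gegenbauerKernelOne n m).eval 1 + (1 - ε) * ((m + (n - 2)).choose (n - 2) : ℝ) <
      levenshteinBound n k ε s) {q : ℝ[X]} (hq0 : q ≠ 0) (hq : q.degree < m) :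
    0 < gegenbauerMean hn ((C s - X) * (1 - X) * ((1 + X) ^ (1 - ε) * q ^ 2)) := by
  have hnn (r : ℝ[X]) (hr : r.degree < m) :
      0 ≤ gegenbauerMean hn ((C s - X) * (1 - X) * ((1 + X) ^ (1 - ε) * r ^ 2)) := by
    refine hΦ _ ?_ fun t ht => ?_
    · rcases Nat.eq_zero_or_pos m with rfl | hmp
      · have : r = 0 := by simpa [Nat.WithBot.lt_zero_iff] using hr
        rw [this]
        simp only [ne_eq, OfNat.ofNat_ne_zero, not_false_eq_true, zero_pow, mul_zero, degree_zero]
        exact WithBot.bot_lt_coe _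
      · obtain ⟨M, rfl⟩ := Nat.exists_eq_add_of_le' hmp
        rw [pow_two]
        refine (degree_mul_lt_add (degree_one_add_X_pow_lt (1 - ε))
          (degree_mul_lt_add hr hr)).trans_le ?_
        norm_cast; lia
    · have h2 : 0 ≤ 1 + t := by linarith [ht.1]
      simp only [eval_mul, eval_add, eval_one, eval_X, eval_pow]
      positivity
  refine (hnn q hq).lt_of_ne fun h0 => ?_
  refine (levenshteinBound_le_of_orthogonal hn hk hε hm hs hq0 hq fun r hr => ?_).not_gt hlow
  -- The form at q + x r is a quadratic in x without constant term; being nonnegative, it has no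
  -- linear term either.
  have hquad (x : ℝ) : 0 ≤
      gegenbauerMean hn ((C s - X) * (1 - X) * ((1 + X) ^ (1 - ε) * r ^ 2)) * (x * x) +
      2 * gegenbauerMean hn ((C s - X) * (1 - X) * ((1 + X) ^ (1 - ε) * q) * r) * x + 0 := by
    have h1 := hnn (q + C x * r) ((degree_add_le _ _).trans_lt (max_lt hq (by
      rw [← smul_eq_C_mul]; exact (degree_smul_le _ _).trans_lt hr)))
    have h2 : (C s - X) * (1 - X) * ((1 + X) ^ (1 - ε) * (q + C x * r) ^ 2) =
        (C s - X) * (1 - X) * ((1 + X) ^ (1 - ε) * q ^ 2) +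
        (C (x * x) * ((C s - X) * (1 - X) * ((1 + X) ^ (1 - ε) * r ^ 2)) +
        C (2 * x) * ((C s - X) * (1 - X) * ((1 + X) ^ (1 - ε) * q) * r)) := by
      simp only [C_mul, C_ofNat]; ring
    rw [h2, map_add, map_add, gegenbauerMean_C_mul, gegenbauerMean_C_mul, ← h0] at h1
    linarith
  have := discrim_le_zero hquad
  rw [discrim] at this
  nlinarith [sq_nonneg (gegenbauerMean hn ((C s - X) * (1 - X) * ((1 + X) ^ (1 - ε) * q) * r))]

/-- For ε = 1 the factor (1 + X)^2 is absorbed into the square of (1 + X)q. -/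
theorem gegenbauerMean_mul_one_add_X_sq_pos {n k ε m : ℕ} (hn : 2 ≤ n) (hk : 1 ≤ k) (hε : ε ≤ 1)
    (hm : k + ε = m + 1) {s : ℝ} (hs : s < 1) (hΦ : NonnegBelow hn s (2 * k - 2 + ε))
    (hlow : (gegenbauerKernelOne n m).eval 1 + (1 - ε) * ((m + (n - 2)).choose (n - 2) : ℝ) <
      levenshteinBound n k ε s) {q : ℝ[X]} (hq0 : q ≠ 0) (hq : q.degree < (k - 1 : ℕ)) :
    0 < gegenbauerMean hn ((C s - X) * (1 + X) * q ^ 2 * ((1 - X) * (1 + X) ^ ε)) := by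
  obtain rfl | rfl : ε = 0 ∨ ε = 1 := by lia
  · have h := gegenbauerMean_mul_sq_pos hn hk hε hm hs hΦ hlow hq0
      (hq.trans_le (by norm_cast; lia))
    convert h using 2
    ring
  · have h := gegenbauerMean_mul_sq_pos hn hk hε hm hs hΦ hlow (q := (1 + X) * q)
      (mul_ne_zero (by rw [add_comm, ← C_1]; exact X_add_C_ne_zero 1) hq0) (by
        have := degree_mul_lt_add (degree_one_add_X_pow_lt 1) hq
        rw [pow_one] at this
        exact this.trans_le (by norm_cast; lia))
    convert h using 2
    ring

/-- Split 1 = ((1 + X) + (1 - X))/2: the first half is positive, the second nonnegative. -/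
theorem gegenbauerMean_mul_sq_weight_pos {n k ε m : ℕ} (hn : 2 ≤ n) (hk : 1 ≤ k) (hε : ε ≤ 1)
    (hm : k + ε = m + 1) {s : ℝ} (hs : s < 1) (hΦ : NonnegBelow hn s (2 * k - 2 + ε))
    (hlow : (gegenbauerKernelOne n m).eval 1 + (1 - ε) * ((m + (n - 2)).choose (n - 2) : ℝ) <
      levenshteinBound n k ε s) {q : ℝ[X]} (hq0 : q ≠ 0) (hq : q.degree < (k - 1 : ℕ)) :
    0 < gegenbauerMean hn ((C s - X) * q ^ 2 * ((1 - X) * (1 + X) ^ ε)) := by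
  have h1 := gegenbauerMean_mul_one_add_X_sq_pos hn hk hε hm hs hΦ hlow hq0 hq
  have h2 := hΦ ((1 - X) * ((1 + X) ^ ε * q ^ 2)) (by
      have hk1 : 1 ≤ k - 1 := by
        by_contra! hk1
        rw [show k - 1 = 0 by lia] at hq
        exact hq0 (by simpa [Nat.WithBot.lt_zero_iff] using hq)
      obtain ⟨κ, hκ⟩ := Nat.exists_eq_add_of_le' hk1
      rw [hκ] at hq
      have h := degree_X_sub_C_mul_lt 1 (degree_mul_lt_add (degree_one_add_X_pow_lt ε)
          (degree_mul_lt_add hq hq))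
      rw [pow_two, ← degree_neg, ← neg_mul, neg_sub, ← C_1]
      rw [C_1] at h ⊢
      exact h.trans_le (by norm_cast; lia)) fun t ht => by
    have h3 : 0 ≤ 1 - t := by linarith [ht.2]
    have h4 : 0 ≤ 1 + t := by linarith [ht.1]
    simp only [eval_mul, eval_add, eval_sub, eval_one, eval_X, eval_pow]
    positivity
  have h3 : (C s - X) * q ^ 2 * ((1 - X) * (1 + X) ^ ε) =
      C (1 / 2) * ((C s - X) * (1 + X) * q ^ 2 * ((1 - X) * (1 + X) ^ ε)) +
      C (1 / 2) * ((C s - X) * (1 - X) * ((1 - X) * ((1 + X) ^ ε * q ^ 2))) := by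
    have e2 : (C (1 / 2) * 2 : ℝ[X]) = 1 := by
      rw [← C_ofNat, ← C_mul]; norm_num
    linear_combination (-((C s - X) * q ^ 2 * ((1 - X) * (1 + X) ^ ε))) * e2
  rw [h3, map_add, gegenbauerMean_C_mul, gegenbauerMean_C_mul]
  linarith

/-! ### Roots of the kernel and structure of the nodes. -/

theorem degree_mul_lt_of_mul_eq {K A r : ℝ[X]} {κ d : ℕ} (hK : K.degree < (κ + 1 : ℕ))
    (hK0 : K ≠ 0) (h : K = A * r) (hA : A.natDegree = d + 1) :
    r ≠ 0 ∧ ∀ B : ℝ[X], B.natDegree ≤ d → (B * r).degree < κ := by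
  subst h
  have hA0 : A ≠ 0 := left_ne_zero_of_mul hK0
  have hr0 : r ≠ 0 := right_ne_zero_of_mul hK0
  have h1 : (A * r).natDegree < κ + 1 := (natDegree_lt_iff_degree_lt hK0).2 hK
  rw [natDegree_mul hA0 hr0, hA] at h1
  refine ⟨hr0, fun B hB => ?_⟩
  rcases eq_or_ne B 0 with rfl | hB0
  · rw [zero_mul, degree_zero]; exact WithBot.bot_lt_coe _
  · rw [← natDegree_lt_iff_degree_lt (mul_ne_zero hB0 hr0), natDegree_mul hB0 hr0]
    lia

/-- A polynomial of degree at most `κ` that is orthogonal to all lower degrees with respect to a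
positive definite functional has `κ` simple real roots. -/
theorem roots_of_orthogonal (φ : ℝ[X] →ₗ[ℝ] ℝ) {κ : ℕ}
    (hpos : ∀ q : ℝ[X], q ≠ 0 → q.degree < κ → 0 < φ (q ^ 2)) {K : ℝ[X]} (hK0 : K ≠ 0)
    (hK : K.degree < (κ + 1 : ℕ)) (horth : ∀ q : ℝ[X], q.degree < κ → φ (K * q) = 0) :
    Multiset.card K.roots = κ ∧ K.roots.Nodup := by
  -- A factor (X - a)^2 + b^2 is impossible: testing K against its cofactor r gives φ(((X - a)r)^2)
  -- + b^2 φ(r^2) > 0. This excludes nonreal roots and, with b = 0, double ones.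
  have hquad (a b : ℝ) (r : ℝ[X]) (h : K = ((X - C a) ^ 2 + C (b ^ 2)) * r) : False := by
    have hnd : ((X - C a) ^ 2 + C (b ^ 2)).natDegree = 1 + 1 := by
      rw [natDegree_add_C, natDegree_pow, natDegree_X_sub_C]
    obtain ⟨hr0, hB⟩ := degree_mul_lt_of_mul_eq hK hK0 h hnd
    have h1 := hB (X - C a) (natDegree_X_sub_C a).le
    have hr : r.degree < κ := by simpa using hB 1 (by simp)
    have h2 := hpos _ (mul_ne_zero (X_sub_C_ne_zero a) hr0) h1
    have h3 := hpos r hr0 hr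
    have h4 : K * r = ((X - C a) * r) ^ 2 + (b ^ 2) • r ^ 2 := by
      rw [h, smul_eq_C_mul]; ring
    have h5 := horth r hr
    rw [h4, map_add, map_smul, smul_eq_mul] at h5
    nlinarith [mul_nonneg (sq_nonneg b) h3.le]
  have hnat : K.natDegree = κ := by
    refine le_antisymm (Nat.lt_succ_iff.1 ((natDegree_lt_iff_degree_lt hK0).2 hK)) ?_
    by_contra! hlt
    have hd : K.degree < κ := (natDegree_lt_iff_degree_lt hK0).1 hlt
    have h1 := horth K hd
    rw [← pow_two] at h1
    exact (hpos K hK0 hd).ne' h1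
  constructor
  · obtain ⟨q, hq, hcard, hroots⟩ := exists_prod_multiset_X_sub_C_mul K
    rw [← hnat, ← hcard]
    suffices q.natDegree = 0 by lia
    by_contra hne
    obtain ⟨z, hz⟩ := IsAlgClosed.exists_aeval_eq_zero ℂ q
      (fun h => hne (natDegree_eq_of_degree_eq_some h))
    have hq0 : q ≠ 0 := by rintro rfl; simp at hne
    rcases eq_or_ne z.im 0 with him | him
    · have hz' : z = algebraMap ℝ ℂ z.re := by
        apply Complex.ext <;> simp [him]
      rw [hz', aeval_algebraMap_apply, coe_aeval_eq_eval, map_eq_zero] at hz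
      have : z.re ∈ q.roots := (mem_roots hq0).2 hz
      rw [hroots] at this
      simp at this
    · obtain ⟨r, hr⟩ := quadratic_dvd_of_aeval_eq_zero_im_ne_zero q hz him
      refine hquad z.re z.im ((K.roots.map fun a => X - C a).prod * r) ?_
      have hnorm : ‖z‖ ^ 2 = z.re ^ 2 + z.im ^ 2 := by
        rw [← Complex.normSq_eq_norm_sq, Complex.normSq_apply]; ring
      have hr' := hr
      rw [hnorm] at hr'
      calc K = (K.roots.map fun a => X - C a).prod * q := hq.symm
        _ = _ := by
          rw [hr']
          simp only [C_add, C_mul, C_pow, C_ofNat]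
          ring
  · rw [Multiset.nodup_iff_count_le_one]
    intro a
    by_contra! h
    rw [count_roots] at h
    obtain ⟨r, hr⟩ := (le_rootMultiplicity_iff hK0).1 (Nat.succ_le_of_lt h)
    exact hquad a 0 r (by rw [hr]; simp)

theorem levenshteinKernel_ne_zero {n : ℕ} (hn : 2 ≤ n) {k : ℕ} (hk : 1 ≤ k) (ε : ℕ) (s : ℝ) :
    levenshteinKernel n k ε s ≠ 0 := by
  intro h
  have h1 := gegenbauerMean_levenshteinKernel_mul hn k ε s (q := 1)
    (by rw [degree_one]; exact_mod_cast hk)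
  rw [h] at h1
  simp at h1

/-- The Christoffel-Darboux kernel has `k - 1` simple roots, all in `(-1, s)`. -/
theorem levenshteinKernel_roots {n k ε m : ℕ} (hn : 2 ≤ n) (hk : 1 ≤ k) (hε : ε ≤ 1)
    (hm : k + ε = m + 1) {s : ℝ} (hs : s < 1) (hΦ : NonnegBelow hn s (2 * k - 2 + ε))
    (hlow : (gegenbauerKernelOne n m).eval 1 + (1 - ε) * ((m + (n - 2)).choose (n - 2) : ℝ) <
      levenshteinBound n k ε s) :
    Multiset.card (levenshteinKernel n k ε s).roots = k - 1 ∧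
      (levenshteinKernel n k ε s).roots.Nodup ∧
      ∀ α ∈ (levenshteinKernel n k ε s).roots, -1 < α ∧ α < s := by
  have hpos (q : ℝ[X]) := gegenbauerMean_mul_sq_weight_pos hn hk hε hm hs hΦ hlow (q := q)
  have hpos1 (q : ℝ[X]) := gegenbauerMean_mul_one_add_X_sq_pos hn hk hε hm hs hΦ hlow (q := q)
  obtain ⟨κ, rfl⟩ := Nat.exists_eq_add_of_le' hk
  simp only [Nat.add_sub_cancel] at hpos hpos1 ⊢
  obtain ⟨K, hKdef⟩ : ∃ K, K = levenshteinKernel n (κ + 1) ε s := ⟨_, rfl⟩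
  have hK0 : K ≠ 0 := hKdef ▸ levenshteinKernel_ne_zero hn hk ε s
  have hK : K.degree < (κ + 1 : ℕ) := hKdef ▸ levenshteinKernel_degree_lt hn _ ε s
  rw [← hKdef]
  obtain ⟨w, hw⟩ : ∃ w : ℝ[X], w = (1 - X) * (1 + X) ^ ε := ⟨_, rfl⟩
  rw [← hw] at hpos hpos1
  have horth (q : ℝ[X]) (hq : q.degree < κ) :
      gegenbauerMean hn ((C s - X) * (K * q) * w) = 0 := by
    have h := gegenbauerMean_levenshteinKernel_mul hn (κ + 1) ε s (degree_X_sub_C_mul_lt s hq)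
    rw [eval_mul, eval_sub, eval_X, eval_C, sub_self, zero_mul, ← hKdef, ← hw] at h
    have e : (C s - X) * (K * q) * w = C (-1) * (K * ((X - C s) * q) * w) := by
      rw [C_neg, C_1]; ring
    rw [e, gegenbauerMean_C_mul, h, mul_zero]
  obtain ⟨h1, h2⟩ := roots_of_orthogonal
    (gegenbauerMean hn ∘ₗ LinearMap.mulRight ℝ w ∘ₗ LinearMap.mulLeft ℝ (C s - X))
    (κ := κ) (fun q hq0 hq => by simpa using hpos q hq0 hq) hK0 hK
    (fun q hq => by simpa using horth q hq)
  refine ⟨h1, h2, fun α hα => ?_⟩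
  -- Testing K = (X - α)r against r gives mean zero for (s - t)(t - α)r^2 w. For α ≤ -1 write t - α
  -- = (1 + t) + (-1 - α), for α ≥ s write (s - t)(t - α) = -(t - s)^2 + (s - α)(s - t); the mean
  -- would be positive, respectively negative.
  obtain ⟨r, hr⟩ := dvd_iff_isRoot.2 (isRoot_of_mem_roots hα)
  obtain ⟨hr0, hB⟩ := degree_mul_lt_of_mul_eq (d := 0) hK hK0 hr (natDegree_X_sub_C α)
  have h3 : r.degree < κ := by simpa using hB 1 (by simp)
  have h4 := horth r h3
  have h5 := hpos r hr0 h3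
  have h6 := hpos1 r hr0 h3
  rw [hr] at h4
  constructor
  · by_contra! hle
    have e : (C s - X) * ((X - C α) * r * r) * w =
        (C s - X) * (1 + X) * r ^ 2 * w + C (-1 - α) * ((C s - X) * r ^ 2 * w) := by
      simp only [C_sub, C_neg, C_1]; ring
    rw [e, map_add, gegenbauerMean_C_mul] at h4
    nlinarith [mul_nonneg (show 0 ≤ -1 - α by linarith) h5.le]
  · by_contra! hle
    have h7 : 0 < gegenbauerMean hn ((X - C s) ^ 2 * r ^ 2 * w) := by
      refine gegenbauerMean_pos hn (fun t ht => ?_) ?_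
      · have g1 : 0 ≤ 1 - t := by linarith [ht.2]
        have g2 : 0 ≤ 1 + t := by linarith [ht.1]
        rw [hw]
        simp only [eval_mul, eval_sub, eval_add, eval_one, eval_X, eval_pow, eval_C]
        positivity
      · refine mul_ne_zero (mul_ne_zero (pow_ne_zero _ (X_sub_C_ne_zero s)) (pow_ne_zero _ hr0)) ?_
        rw [hw]
        refine mul_ne_zero ?_ (pow_ne_zero _ ?_)
        · rw [← neg_sub, ← C_1]; exact neg_ne_zero.2 (X_sub_C_ne_zero 1)
        · rw [add_comm, ← C_1]; exact X_add_C_ne_zero 1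
    have e : (C s - X) * ((X - C α) * r * r) * w =
        C (-1) * ((X - C s) ^ 2 * r ^ 2 * w) + C (s - α) * ((C s - X) * r ^ 2 * w) := by
      simp only [C_sub, C_neg, C_1]; ring
    rw [e, map_add, gegenbauerMean_C_mul, gegenbauerMean_C_mul] at h4
    nlinarith [mul_nonneg (show 0 ≤ α - s by linarith) h5.le]

/-- For s ≤ -1 the function (s - t)(1 - t) is nonpositive on (-1, 1), against its positive mean. -/
theorem neg_one_lt_of_gegenbauerMean_pos {n k m : ℕ} (hn : 2 ≤ n) (hk : 1 ≤ k)
    (hm : k + 1 = m + 1) {s : ℝ} (hs : s < 1) (hΦ : NonnegBelow hn s (2 * k - 2 + 1))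
    (hlow : (gegenbauerKernelOne n m).eval 1 <
      levenshteinBound n k 1 s) : -1 < s := by
  have h := gegenbauerMean_mul_sq_pos hn hk le_rfl hm hs hΦ (by simpa using hlow) (q := 1)
    one_ne_zero (by rw [degree_one]; norm_cast; lia)
  by_contra! hle
  have h2 := gegenbauerMean_nonneg hn (f := C (-1) * ((C s - X) * (1 - X) * ((1 + X) ^ (1 - 1) * 1 ^ 2)))
    fun t ht => by
      have g1 : 0 ≤ 1 - t := by linarith [ht.2]
      have g2 : 0 ≤ t - s := by linarith [ht.1]
      simp
      nlinarith [mul_nonneg g2 g1]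
  rw [gegenbauerMean_C_mul] at h2
  linarith

theorem levenshteinPoly_roots {n k ε : ℕ} (hn : 2 ≤ n) (hk : 1 ≤ k) (s : ℝ) :
    interpolationNodes n k ε s =
      {s} + ε • {-1} + 2 • (levenshteinKernel n k ε s).roots := by
  have h1 : (X + 1 : ℝ[X]) ≠ 0 := by rw [← C_1]; exact X_add_C_ne_zero 1
  have h2 : (X + 1 : ℝ[X]).roots = {-1} := by
    rw [show (X + 1 : ℝ[X]) = X - C (-1) by simp, roots_X_sub_C]
  have h3 := levenshteinKernel_ne_zero hn hk ε s
  have h4 := mul_ne_zero (X_sub_C_ne_zero s) (pow_ne_zero ε h1)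
  rw [interpolationNodes, levenshteinPoly, roots_mul (mul_ne_zero h4 (pow_ne_zero 2 h3)),
    roots_mul h4, roots_pow, roots_pow, roots_X_sub_C, h2]

/-- The structure of the nodes, as a multiset: `s` and (for `ε = 1`) `-1` are simple, and the
others are double and lie strictly between. -/
theorem interpolationNodes_structure {n k ε m : ℕ} (hn : 2 ≤ n) (hk : 1 ≤ k) (hε : ε ≤ 1)
    (hm : k + ε = m + 1) {s : ℝ} (hs : s < 1)
    (hΦ : NonnegBelow hn s (2 * k - 2 + ε))
    (hlow : (gegenbauerKernelOne n m).eval 1 + (1 - ε) * ((m + (n - 2)).choose (n - 2) : ℝ) <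
      levenshteinBound n k ε s) :
    ∃ A D : Finset ℝ, interpolationNodes n k ε s = {s} + A.val + 2 • D.val ∧ A.card = ε ∧
      D.card = k - 1 ∧ A ⊆ {-1} ∧ (∀ α ∈ A, α < s) ∧ (∀ α ∈ D, -1 < α ∧ α < s) ∧
      (X + 1 : ℝ[X]) ^ ε = ∏ α ∈ A, (X - C α) ∧
      ∃ b : ℝ, levenshteinKernel n k ε s = C b * ∏ α ∈ D, (X - C α) := by
  obtain ⟨h1, h2, h3⟩ := levenshteinKernel_roots hn hk hε hm hs hΦ hlow
  have hD : (levenshteinKernel n k ε s).roots.toFinset.val = (levenshteinKernel n k ε s).roots := by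
    rw [Multiset.toFinset_val, Multiset.dedup_eq_self.2 h2]
  have hsplit : (levenshteinKernel n k ε s).roots.card = (levenshteinKernel n k ε s).natDegree := by
    refine le_antisymm (card_roots' _) ?_
    rw [h1]
    have := (natDegree_lt_iff_degree_lt (levenshteinKernel_ne_zero hn hk ε s)).2
      (levenshteinKernel_degree_lt hn k ε s)
    lia
  have hprod : ∃ b : ℝ, levenshteinKernel n k ε s =
      C b * ∏ α ∈ (levenshteinKernel n k ε s).roots.toFinset, (X - C α) := by
    refine ⟨(levenshteinKernel n k ε s).leadingCoeff, ?_⟩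
    rw [Finset.prod, hD, C_leadingCoeff_mul_prod_multiset_X_sub_C hsplit]
  have hDcard : (levenshteinKernel n k ε s).roots.toFinset.card = k - 1 := by
    rw [Multiset.toFinset_card_of_nodup h2, h1]
  obtain rfl | rfl : ε = 0 ∨ ε = 1 := by lia
  · refine ⟨∅, (levenshteinKernel n k 0 s).roots.toFinset, ?_, rfl, hDcard, by simp, by simp,
      by simpa using h3, by simp, hprod⟩
    rw [levenshteinPoly_roots hn hk, hD]; simp
  · have hs2 : -1 < s := neg_one_lt_of_gegenbauerMean_pos hn hk hm hs hΦ (by simpa using hlow)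
    refine ⟨{-1}, (levenshteinKernel n k 1 s).roots.toFinset, ?_, rfl, hDcard, by simp, by simpa,
      by simpa using h3, by simp, hprod⟩
    rw [levenshteinPoly_roots hn hk, hD]; simp

/-! ### Hermite interpolation and the sign of its error. -/

theorem prod_X_sub_C_ne_zero (T : Multiset ℝ) : (T.map fun a => X - C a).prod ≠ 0 :=
  (monic_multiset_prod_of_monic _ _ fun a _ => monic_X_sub_C a).ne_zero

theorem rootMultiplicity_prod_X_sub_C (T : Multiset ℝ) (t : ℝ) :
    (T.map fun a => X - C a).prod.rootMultiplicity t = T.count t := by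
  rw [← count_roots, roots_multiset_prod_X_sub_C]

/-- Newton's induction: a multiple of the nodal polynomial of the old nodes leaves all earlier data
intact and adjusts the one new datum at `a`. -/
theorem exists_hermiteInterpolant (v : ℝ → ℕ → ℝ) (T : Multiset ℝ) :
    ∃ g : ℝ[X], g.degree < (Multiset.card T : WithBot ℕ) ∧
      ∀ t ∈ T, ∀ j < T.count t, (derivative^[j] g).eval t = v t j := by
  induction T using Multiset.induction_on with
  | empty => exact ⟨0, by simp, by simp⟩
  | cons a T ih =>
    obtain ⟨g, hgd, hg⟩ := ih
    set ω : ℝ[X] := (T.map fun a => X - C a).prod with hω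
    have hω0 : ω ≠ 0 := prod_X_sub_C_ne_zero T
    have hωd : ω.degree = (Multiset.card T : WithBot ℕ) := by
      rw [hω, degree_eq_natDegree hω0, natDegree_multiset_prod_X_sub_C_eq_card]
    have hzero (t : ℝ) (j : ℕ) (hj : j < T.count t) : (derivative^[j] ω).eval t = 0 := by
      rw [← rootMultiplicity_prod_X_sub_C,
        lt_rootMultiplicity_iff_isRoot_iterate_derivative hω0] at hj
      exact hj j le_rfl
    have hne : (derivative^[T.count a] ω).eval a ≠ 0 := by
      intro h0
      have : T.count a < ω.rootMultiplicity a := by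
        rw [lt_rootMultiplicity_iff_isRoot_iterate_derivative hω0]
        intro j hj
        rcases hj.eq_or_lt with rfl | hlt
        · exact h0
        · exact hzero a j hlt
      rw [rootMultiplicity_prod_X_sub_C] at this
      exact lt_irrefl _ this
    set b : ℝ := (v a (T.count a) - (derivative^[T.count a] g).eval a) /
      (derivative^[T.count a] ω).eval a with hb
    have heval (t : ℝ) (j : ℕ) : (derivative^[j] (g + C b * ω)).eval t =
        (derivative^[j] g).eval t + b * (derivative^[j] ω).eval t := by
      rw [iterate_map_add, iterate_derivative_C_mul, eval_add, eval_C_mul]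
    refine ⟨g + C b * ω, ?_, fun t ht j hj => ?_⟩
    · rw [Multiset.card_cons]
      refine (degree_add_le _ _).trans_lt (max_lt (hgd.trans (by norm_cast; lia)) ?_)
      rw [← smul_eq_C_mul]
      refine (degree_smul_le _ _).trans_lt ?_
      rw [hωd]; norm_cast; lia
    · rw [heval]
      have hold (hj' : j < T.count t) :
          (derivative^[j] g).eval t + b * (derivative^[j] ω).eval t = v t j := by
        rw [hzero t j hj', mul_zero, add_zero]
        exact hg t (Multiset.count_pos.1 (by lia)) j hj'
      by_cases hta : t = a
      · subst hta
        rw [Multiset.count_cons_self, Nat.lt_succ_iff] at hj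
        rcases hj.eq_or_lt with rfl | hlt
        · rw [hb, div_mul_cancel₀ _ hne]; ring
        · exact hold hlt
      · rw [Multiset.count_cons_of_ne hta] at hj
        exact hold hj

theorem IsHermiteInterpolant.unique {h : ℝ → ℝ} {T : Multiset ℝ} {g₁ g₂ : ℝ[X]}
    (h₁ : IsHermiteInterpolant h T g₁) (h₂ : IsHermiteInterpolant h T g₂) : g₁ = g₂ := by
  rw [← sub_eq_zero]
  by_contra h0
  have hle : T ≤ (g₁ - g₂).roots := by
    rw [Multiset.le_iff_count]
    intro t
    rcases Nat.eq_zero_or_pos (T.count t) with hc | hc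
    · rw [hc]; exact Nat.zero_le _
    · obtain ⟨j, hj⟩ := Nat.exists_eq_add_of_le' hc
      rw [count_roots, hj, Nat.succ_le_iff, lt_rootMultiplicity_iff_isRoot_iterate_derivative h0]
      intro i hi
      have ht := Multiset.count_pos.1 hc
      rw [IsRoot.def, iterate_derivative_sub, eval_sub, h₁.2 t ht i (by lia),
        h₂.2 t ht i (by lia), sub_self]
  have h3 := (Multiset.card_le_card hle).trans (card_roots' _)
  have h4 : (g₁ - g₂).degree < (Multiset.card T : WithBot ℕ) :=
    (degree_sub_le _ _).trans_lt (max_lt h₁.1 h₂.1)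
  rw [← natDegree_lt_iff_degree_lt h0] at h4
  exact h3.not_gt h4

/-- Rolle with double zeros: each gap of Z yields a new critical point outside Z, and the double
zeros D, lying in Z, are counted in addition. Only continuity is needed at the left end. -/
theorem exists_finset_deriv_eq_zero {f : ℝ → ℝ} {a b : ℝ} (hf : ContinuousOn f (Set.Ico a b))
    {Z D : Finset ℝ} (hZ : ∀ z ∈ Z, z ∈ Set.Ico a b ∧ f z = 0) (hDZ : D ⊆ Z)
    (hD : ∀ z ∈ D, z ∈ Set.Ioo a b ∧ deriv f z = 0) :
    ∃ Z' : Finset ℝ, (∀ z ∈ Z', z ∈ Set.Ioo a b ∧ deriv f z = 0) ∧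
      Z.card + D.card ≤ Z'.card + 1 := by
  have hex (x y : ℝ) : ∃ c, x ∈ Z → y ∈ Z → x < y → c ∈ Set.Ioo x y ∧ deriv f c = 0 := by
    by_cases hxy : x ∈ Z ∧ y ∈ Z ∧ x < y
    · obtain ⟨hx, hy, hlt⟩ := hxy
      obtain ⟨c, hc, hc0⟩ := exists_deriv_eq_zero hlt
        (hf.mono fun t ht => ⟨(hZ x hx).1.1.trans ht.1, ht.2.trans_lt (hZ y hy).1.2⟩)
        ((hZ x hx).2.trans (hZ y hy).2.symm)
      exact ⟨c, fun _ _ _ => ⟨hc, hc0⟩⟩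
    · exact ⟨0, fun hx hy hlt => (hxy ⟨hx, hy, hlt⟩).elim⟩
  choose ξ hξ using hex
  set W : Finset ℝ := ((Z ×ˢ Z).filter fun p => p.1 < p.2).image fun p => ξ p.1 p.2 with hW
  have hWmem (z : ℝ) (hz : z ∈ W) : z ∈ Set.Ioo a b ∧ deriv f z = 0 := by
    simp only [hW, Finset.mem_image, Finset.mem_filter, Finset.mem_product] at hz
    obtain ⟨⟨x, y⟩, ⟨⟨hx, hy⟩, hlt⟩, rfl⟩ := hz
    have h1 := hξ x y hx hy hlt
    exact ⟨⟨(hZ x hx).1.1.trans_lt h1.1.1, h1.1.2.trans (hZ y hy).1.2⟩, h1.2⟩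
  have hcard : Z.card ≤ (W \ Z).card + 1 := by
    refine Finset.card_le_sdiff_of_interleaved fun x hx y hy hlt _ => ?_
    refine ⟨ξ x y, ?_, (hξ x y hx hy hlt).1⟩
    simp only [hW, Finset.mem_image, Finset.mem_filter, Finset.mem_product]
    exact ⟨⟨x, y⟩, ⟨⟨hx, hy⟩, hlt⟩, rfl⟩
  refine ⟨(W \ Z) ∪ D, fun z hz => ?_, ?_⟩
  · rcases Finset.mem_union.1 hz with h | h
    · exact hWmem z (Finset.mem_sdiff.1 h).1
    · exact hD z h
  · rw [Finset.card_union_of_disjoint (Finset.disjoint_of_subset_right hDZ Finset.sdiff_disjoint)]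
    lia

/-- Iterated Rolle theorem. -/
theorem exists_iteratedDeriv_eq_zero {a b : ℝ} (m : ℕ) {f : ℝ → ℝ}
    (hf : ∀ j < m, DifferentiableOn ℝ (iteratedDeriv j f) (Set.Ioo a b)) {Z : Finset ℝ}
    (hZ : ∀ z ∈ Z, z ∈ Set.Ioo a b ∧ f z = 0) (hcard : m + 1 ≤ Z.card) :
    ∃ ξ ∈ Set.Ioo a b, iteratedDeriv m f ξ = 0 := by
  induction m generalizing f Z with
  | zero =>
    obtain ⟨z, hz⟩ := Finset.card_pos.1 (by lia : 0 < Z.card)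
    exact ⟨z, (hZ z hz).1, by simpa using (hZ z hz).2⟩
  | succ m ih =>
    have hZ0 : Z.Nonempty := Finset.card_pos.1 (by lia)
    have hmin := hZ _ (Z.min'_mem hZ0)
    have hcont : ContinuousOn f (Set.Ico (Z.min' hZ0) b) := by
      have := (hf 0 (by lia)).continuousOn
      rw [iteratedDeriv_zero] at this
      exact this.mono fun t ht => ⟨hmin.1.1.trans_le ht.1, ht.2⟩
    obtain ⟨Z', hZ', hc⟩ := exists_finset_deriv_eq_zero hcont (Z := Z) (D := ∅)
      (fun z hz => ⟨⟨Z.min'_le z hz, (hZ z hz).1.2⟩, (hZ z hz).2⟩) (Finset.empty_subset _) (by simp)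
    rw [iteratedDeriv_succ']
    refine ih (fun j hj => ?_) (fun z hz => ⟨⟨hmin.1.1.trans (hZ' z hz).1.1, (hZ' z hz).1.2⟩,
      (hZ' z hz).2⟩) (by simp at hc; lia)
    rw [← iteratedDeriv_succ']
    exact hf (j + 1) (by lia)

theorem iteratedDeriv_sub_eval {h : ℝ → ℝ} {a b : ℝ} {τ : ℕ}
    (hdiff : ∀ j < τ, DifferentiableOn ℝ (iteratedDeriv j h) (Set.Ioo a b)) (p : ℝ[X]) {j : ℕ}
    (hj : j ≤ τ) {x : ℝ} (hx : x ∈ Set.Ioo a b) :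
    iteratedDeriv j (fun t => h t - p.eval t) x =
      iteratedDeriv j h x - (derivative^[j] p).eval x := by
  induction j generalizing x with
  | zero => simp
  | succ j ih =>
    have hev : iteratedDeriv j (fun t => h t - p.eval t) =ᶠ[nhds x]
        fun t => iteratedDeriv j h t - (derivative^[j] p).eval t :=
      Filter.eventually_of_mem (isOpen_Ioo.mem_nhds hx) fun t ht => ih (by lia) ht
    rw [iteratedDeriv_succ, hev.deriv_eq, iteratedDeriv_succ, Function.iterate_succ_apply',
      deriv_fun_sub ((hdiff j (by lia)).differentiableAt (isOpen_Ioo.mem_nhds hx))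
        (Polynomial.differentiableAt _), Polynomial.deriv]

theorem iterate_derivative_eval_of_monic {ω : ℝ[X]} (hω : ω.Monic) (x : ℝ) :
    (derivative^[ω.natDegree] ω).eval x = ω.natDegree.factorial := by
  have h1 := natDegree_iterate_derivative ω ω.natDegree
  rw [Nat.sub_self, Nat.le_zero] at h1
  rw [eq_C_of_natDegree_eq_zero h1, eval_C, coeff_iterate_derivative, zero_add,
    Nat.descFactorial_self, coeff_natDegree, hω.leadingCoeff, nsmul_one]

/-- The sign of the error of Hermite interpolation with double nodes in the interior. -/
theorem le_eval_of_isHermiteInterpolant {h : ℝ → ℝ} {a b : ℝ} {T : Multiset ℝ} {Z D : Finset ℝ}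
    (hcont : ContinuousOn h (Set.Ico a b))
    (hdiff : ∀ j < Multiset.card T, DifferentiableOn ℝ (iteratedDeriv j h) (Set.Ioo a b))
    (hnonneg : ∀ t ∈ Set.Ioo a b, 0 ≤ iteratedDeriv (Multiset.card T) h t)
    (hT : T = Z.val + D.val) (hDZ : D ⊆ Z) (hZ : ∀ z ∈ Z, z ∈ Set.Ico a b)
    (hD : ∀ z ∈ D, z ∈ Set.Ioo a b) (hTpos : 0 < Multiset.card T) {g : ℝ[X]}
    (hg : IsHermiteInterpolant h T g)
    {x : ℝ} (hx : x ∈ Set.Ico a b) (hω : (T.map fun t => X - C t).prod.eval x ≤ 0) :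
    h x ≤ g.eval x := by
  classical
  have hcount (z : ℝ) (hz : z ∈ Z) : 0 < T.count z := by
    rw [hT, Multiset.count_add]
    exact Nat.add_pos_left (Multiset.count_pos.2 hz) _
  have hgZ (z : ℝ) (hz : z ∈ Z) : g.eval z = h z := by
    simpa using hg.2 z (Multiset.count_pos.1 (hcount z hz)) 0 (hcount z hz)
  by_cases hxZ : x ∈ Z
  · exact (hgZ x hxZ).ge
  set ω : ℝ[X] := (T.map fun t => X - C t).prod with hωdef
  have hωmonic : ω.Monic := monic_multiset_prod_of_monic _ _ fun t _ => monic_X_sub_C t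
  have hωroot (z : ℝ) : ω.IsRoot z ↔ z ∈ T := by
    rw [← mem_roots hωmonic.ne_zero, hωdef, roots_multiset_prod_X_sub_C]
  have hTZ (z : ℝ) (hz : z ∈ T) : z ∈ Z := by
    rw [hT, Multiset.mem_add] at hz
    rcases hz with h | h
    · exact h
    · exact hDZ h
  have hωx : ω.eval x ≠ 0 := fun h0 => hxZ (hTZ x ((hωroot x).1 h0))
  -- This c makes h - g - cω vanish at x as well. Its zeros, counted with multiplicity, number τ +
  -- 1, where τ = card T, so repeated Rolle yields h^(τ)(ξ) = c τ! and hence c ≥ 0.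
  obtain ⟨c, hc⟩ : ∃ c, c = (h x - g.eval x) / ω.eval x := ⟨_, rfl⟩
  have hcx : c * ω.eval x = h x - g.eval x := by rw [hc, div_mul_cancel₀ _ hωx]
  have hωcard : ω.natDegree = Multiset.card T := by
    rw [hωdef, natDegree_multiset_prod_X_sub_C_eq_card]
  set p : ℝ[X] := g + C c * ω with hp
  have hfdiff (j : ℕ) (hj : j < Multiset.card T) :
      DifferentiableOn ℝ (iteratedDeriv j fun t => h t - p.eval t) (Set.Ioo a b) :=
    ((hdiff j hj).sub (derivative^[j] p).differentiable.differentiableOn).congr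
      fun t ht => iteratedDeriv_sub_eval hdiff p hj.le ht
  have hDderiv (z : ℝ) (hz : z ∈ D) : deriv (fun t => h t - p.eval t) z = 0 := by
    have h2 : 1 < T.count z := by
      rw [hT, Multiset.count_add]
      exact Nat.add_lt_add_of_lt_of_le (a := 0) (Multiset.count_pos.2 (hDZ hz))
        (Multiset.count_pos.2 hz)
    have hg1 := hg.2 z (Multiset.count_pos.1 (zero_lt_one.trans h2)) 1 h2
    have hω1 : (derivative^[1] ω).eval z = 0 := by
      rw [← rootMultiplicity_prod_X_sub_C, ← hωdef,
        lt_rootMultiplicity_iff_isRoot_iterate_derivative hωmonic.ne_zero] at h2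
      exact h2 1 le_rfl
    rw [← iteratedDeriv_one, iteratedDeriv_sub_eval hdiff p hTpos (hD z hz), ← hg1, hp,
      iterate_map_add, iterate_derivative_C_mul, eval_add, eval_C_mul, hω1]
    ring
  obtain ⟨Z', hZ', hcard⟩ := exists_finset_deriv_eq_zero (f := fun t => h t - p.eval t)
    (hcont.sub p.continuous.continuousOn) (Z := insert x Z) (D := D)
    (fun z hz => by
      rcases Finset.mem_insert.1 hz with rfl | hz
      · refine ⟨hx, ?_⟩
        rw [hp, eval_add, eval_C_mul, hcx]; ring
      · refine ⟨hZ z hz, ?_⟩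
        have : ω.eval z = 0 := (hωroot z).2 (Multiset.count_pos.1 (hcount z hz))
        rw [hp, eval_add, eval_C_mul, this, hgZ z hz]; ring)
    (hDZ.trans (Finset.subset_insert _ _)) (fun z hz => ⟨hD z hz, hDderiv z hz⟩)
  have hcardT : Multiset.card T = Z.card + D.card := by
    rw [hT, Multiset.card_add, Finset.card_val, Finset.card_val]
  rw [Finset.card_insert_of_notMem hxZ] at hcard
  obtain ⟨m, hm⟩ := Nat.exists_eq_add_of_le' hTpos
  obtain ⟨ξ, hξ, hξ0⟩ := exists_iteratedDeriv_eq_zero m (f := deriv fun t => h t - p.eval t)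
    (fun j hj => by
      rw [← iteratedDeriv_succ']
      exact hfdiff (j + 1) (by lia)) hZ' (by lia)
  rw [← iteratedDeriv_succ', ← hm, iteratedDeriv_sub_eval hdiff p le_rfl hξ, hp, iterate_map_add,
    iterate_derivative_C_mul, iterate_derivative_eq_zero_of_degree_lt hg.1, zero_add, eval_C_mul,
    ← hωcard, iterate_derivative_eval_of_monic hωmonic, hωcard] at hξ0
  have h1 := hnonneg ξ hξ
  have hfac : (0 : ℝ) < (Multiset.card T).factorial := by exact_mod_cast Nat.factorial_pos _
  have hc0 : 0 ≤ c := by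
    by_contra! hneg
    nlinarith [mul_pos_of_neg_of_neg hneg (neg_neg_of_pos hfac)]
  nlinarith [mul_nonneg hc0 (neg_nonneg.2 hω)]

/-! ### The quadrature formula at the nodes. -/

/-- Divide g = I + Pq by the nodal polynomial P. The weights are exact on I by Lagrange
interpolation, and deg q < k makes the mean of Pq equal to P(1)q(1)/L, while Pq vanishes at all
nodes. -/
theorem gegenbauerMean_eq_quadrature {n k ε m : ℕ} (hn : 2 ≤ n) (hk : 1 ≤ k) (hε : ε ≤ 1)
    (hm : k + ε = m + 1) {s : ℝ} (hs : s < 1)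
    (hden : ε * (gegenbauerPoly n k).eval s + (gegenbauerPoly n (m + 1)).eval s ≠ 0)
    (hL : levenshteinBound n k ε s ≠ 0) (hcard : (levenshteinNodes n k ε s).card = k + ε)
    {b : ℝ} (hb : levenshteinNodal n k ε s =
      C b * ∏ α ∈ levenshteinNodes n k ε s, (X - C α)) {g : ℝ[X]}
    (hg : g.degree < (2 * k - 1 + ε : ℕ)) :
    gegenbauerMean hn g = g.eval 1 / levenshteinBound n k ε s +
      ∑ α ∈ levenshteinNodes n k ε s, levenshteinWeight n k ε s α * g.eval α := by
  have hker := gegenbauerMean_levenshteinNodal_mul_levenshteinBound hn hk hε hm hs hden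
  obtain ⟨κ, rfl⟩ := Nat.exists_eq_add_of_le' hk
  set S := levenshteinNodes n (κ + 1) ε s with hS
  set L := levenshteinBound n (κ + 1) ε s with hLdef
  set P : ℝ[X] := ∏ α ∈ S, (X - C α) with hP
  have hPm : P.Monic := monic_prod_of_monic _ _ fun α _ => monic_X_sub_C α
  have hPd : P.natDegree = κ + 1 + ε := by
    rw [hP, natDegree_prod_of_monic _ _ fun α _ => monic_X_sub_C α]
    simp [hcard]
  have hb0 : b ≠ 0 := by
    rintro rfl
    have h1 := mul_ne_zero (mul_ne_zero (X_sub_C_ne_zero s) (pow_ne_zero ε (X_add_C_ne_zero (1 : ℝ))))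
      (levenshteinKernel_ne_zero hn hk ε s)
    rw [C_1, ← levenshteinNodal, hb] at h1
    simp at h1
  set q : ℝ[X] := g /ₘ P with hq
  set I : ℝ[X] := g %ₘ P with hI
  have hsplit : I + P * q = g := modByMonic_add_div g P
  have hqd : q.degree < (κ + 1 : ℕ) := by
    rcases eq_or_ne q 0 with h0 | h0
    · rw [h0, degree_zero]; exact WithBot.bot_lt_coe _
    · rw [← natDegree_lt_iff_degree_lt h0, hq, natDegree_divByMonic g hPm, hPd]
      have hg0 : g ≠ 0 := by rintro rfl; simp [hq] at h0
      have := (natDegree_lt_iff_degree_lt hg0).2 hg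
      lia
  have hId : I.degree < S.card := by
    rw [hcard, ← hPd, ← degree_eq_natDegree hPm.ne_zero]
    exact degree_modByMonic_lt g hPm
  have hProot (α : ℝ) (hα : α ∈ S) : P.eval α = 0 := by
    rw [hP, eval_prod]
    exact Finset.prod_eq_zero hα (by simp)
  have hIeval (α : ℝ) (hα : α ∈ S) : I.eval α = g.eval α := by
    rw [← hsplit, eval_add, eval_mul, hProot α hα]; ring
  have hIsum : I = ∑ α ∈ S, C (g.eval α) * Lagrange.basis S id α := by
    rw [Lagrange.eq_interpolate_of_eval_eq (v := id) (fun α => g.eval α) (Set.injOn_id _) hId hIeval,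
      Lagrange.interpolate_apply]
  have hPq : gegenbauerMean hn (P * q) = P.eval 1 * q.eval 1 / L := by
    have h1 := gegenbauerMean_levenshteinNodal_mul hn κ ε s hqd
    have h2 : gegenbauerMean hn (levenshteinNodal n (κ + 1) ε s) = b * P.eval 1 / L := by
      rw [eq_div_iff hL, hker, hb, eval_C_mul]
    rw [h2, hb, mul_assoc, gegenbauerMean_C_mul] at h1
    apply mul_left_cancel₀ hb0
    rw [h1]; ring
  have hImean : gegenbauerMean hn I =
      ∑ α ∈ S, g.eval α * gegenbauerCoeffZero n (Lagrange.basis S id α) := by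
    rw [hIsum, map_sum]
    exact Finset.sum_congr rfl fun α _ => gegenbauerMean_C_mul hn _ _
  have hI1 : I.eval 1 = ∑ α ∈ S, g.eval α * (Lagrange.basis S id α).eval 1 := by
    rw [hIsum, eval_finsetSum]
    exact Finset.sum_congr rfl fun α _ => eval_C_mul
  have hw : ∑ α ∈ S, levenshteinWeight n (κ + 1) ε s α * g.eval α =
      gegenbauerMean hn I - I.eval 1 / L := by
    rw [hImean, hI1, Finset.sum_div, ← Finset.sum_sub_distrib]
    refine Finset.sum_congr rfl fun α _ => ?_
    rw [levenshteinWeight, ← hS, ← hLdef]; ring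
  have hg1 : g.eval 1 = I.eval 1 + P.eval 1 * q.eval 1 := by
    conv_lhs => rw [← hsplit, eval_add, eval_mul]
  rw [hw, hg1]
  conv_lhs => rw [← hsplit, map_add, hPq]
  ring

/-! ### Sums over the pairs of a weighted code. -/

namespace WeightedCode

variable {n N : ℕ}

/-- The mean of a polynomial over the pairs of points of a weighted code. -/
noncomputable def pairMean (c : WeightedCode n N) : ℝ[X] →ₗ[ℝ] ℝ :=
  ∑ i, ∑ j, (c.weight i * c.weight j) • leval (inner ℝ (c.point i) (c.point j))

theorem pairMean_apply (c : WeightedCode n N) (f : ℝ[X]) : c.pairMean f =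
    ∑ i, ∑ j, c.weight i * c.weight j * f.eval (inner ℝ (c.point i) (c.point j)) := by
  simp [pairMean, LinearMap.sum_apply]

theorem IsDesign.pairMean_eq {c : WeightedCode n N} {τ : ℕ} (hc : c.IsDesign τ) (hn : 2 ≤ n)
    {f : ℝ[X]} (hf : f.degree < (τ + 1 : ℕ)) : c.pairMean f = gegenbauerMean hn f := by
  have h := linearMap_eq_zero_of_degree_lt (c.pairMean - gegenbauerMean hn) (gegenbauerPoly n)
    (gegenbauerPoly_degree hn) (k := τ + 1) (fun l hl => ?_) hf
  · simpa [sub_eq_zero] using h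
  rw [LinearMap.sub_apply]
  rcases Nat.eq_zero_or_pos l with rfl | hl0
  · rw [gegenbauerPoly_zero, gegenbauerMean_one, pairMean_apply]
    simp only [eval_one, mul_one]
    rw [← Finset.sum_mul_sum, c.sum_weight]; ring
  · obtain ⟨i, rfl⟩ := Nat.exists_eq_add_of_le' hl0
    rw [gegenbauerMean_gegenbauerPoly_succ, pairMean_apply]
    have := hc (i + 1) hl0 (by lia)
    rw [moment] at this
    rw [this, sub_zero]

theorem inner_self (c : WeightedCode n N) (i : Fin N) : inner ℝ (c.point i) (c.point i) = 1 := by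
  rw [real_inner_self_eq_norm_sq, c.norm_point]; norm_num

theorem neg_one_le_inner (c : WeightedCode n N) (i j : Fin N) :
    -1 ≤ (inner ℝ (c.point i) (c.point j) : ℝ) := by
  have h := neg_le_of_abs_le (abs_real_inner_le_norm (c.point i) (c.point j))
  rwa [c.norm_point, c.norm_point, one_mul] at h

theorem inner_lt_one (c : WeightedCode n N) {i j : Fin N} (hij : i ≠ j) :
    (inner ℝ (c.point i) (c.point j) : ℝ) < 1 :=
  (inner_lt_one_iff_real_of_norm_eq_one (c.norm_point i) (c.norm_point j)).2
    fun h => hij (c.point_injective h)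

/-- The mean is a sum over pairs: 1 - t kills the diagonal, and off it all inner products are at
most s. -/
theorem IsDesign.nonnegBelow {c : WeightedCode n N} {τ d : ℕ} (hc : c.IsDesign τ) (hn : 2 ≤ n)
    (hd : d + 1 ≤ τ) {s : ℝ} (hs : c.IsMaxInner s) : NonnegBelow hn s d := by
  intro u hu hu0
  have hdeg : ((C s - X) * (1 - X) * u).degree < ((τ + 1 : ℕ) : WithBot ℕ) := by
    have h1 := degree_X_sub_C_mul_lt s (degree_X_sub_C_mul_lt 1 hu)
    rw [show (C s - X) * (1 - X) * u = (X - C s) * ((X - C 1) * u) by rw [C_1]; ring]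
    exact h1.trans_le (by norm_cast; lia)
  rw [← hc.pairMean_eq hn hdeg, pairMean_apply]
  refine Finset.sum_nonneg fun i _ => Finset.sum_nonneg fun j _ => ?_
  refine mul_nonneg (mul_nonneg (c.weight_pos i).le (c.weight_pos j).le) ?_
  rw [eval_mul, eval_mul, eval_sub, eval_sub, eval_C, eval_X, eval_one]
  rcases eq_or_ne i j with rfl | hij
  · rw [c.inner_self]; simp
  · have h1 := hs.2 ⟨i, j, hij, rfl⟩
    have h2 := c.inner_lt_one hij
    exact mul_nonneg (mul_nonneg (by linarith) (by linarith))
      (hu0 _ ⟨c.neg_one_le_inner i j, h2.le⟩)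

theorem energy_eval (c : WeightedCode n N) (g : ℝ[X]) :
    c.energy (fun t => g.eval t) = c.pairMean g - (∑ i, c.weight i ^ 2) * g.eval 1 := by
  rw [energy, pairMean_apply, Finset.sum_mul, ← Finset.sum_sub_distrib]
  refine Finset.sum_congr rfl fun i _ => ?_
  rw [← Finset.sum_erase_add _ _ (Finset.mem_univ i), c.inner_self]
  ring

theorem energy_mono (c : WeightedCode n N) {s : ℝ} (hs : c.IsMaxInner s) {h g : ℝ → ℝ}
    (hhg : ∀ t ∈ Set.Icc (-1 : ℝ) s, h t ≤ g t) : c.energy h ≤ c.energy g := by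
  refine Finset.sum_le_sum fun i _ => Finset.sum_le_sum fun j hj => ?_
  have hij : i ≠ j := (Finset.ne_of_mem_erase hj).symm
  exact mul_le_mul_of_nonneg_left (hhg _ ⟨c.neg_one_le_inner i j, hs.2 ⟨i, j, hij, rfl⟩⟩)
    (mul_pos (c.weight_pos i) (c.weight_pos j)).le

theorem sum_weight_sq_pos (c : WeightedCode n N) (i : Fin N) : 0 < ∑ i, c.weight i ^ 2 :=
  Finset.sum_pos (fun j _ => pow_pos (c.weight_pos j) 2) ⟨i, Finset.mem_univ i⟩

end WeightedCode

/-! ### The energy bound. -/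

theorem theorem5p6 {n N k ε τ : ℕ} (hn : 2 ≤ n) (hk : 1 ≤ k) (hε : ε ≤ 1)
    (hτ : τ = 2 * k - 1 + ε)
    (h : ℝ → ℝ) (hcont : ContinuousOn h (Set.Ico (-1) 1))
    (hdiff : ∀ j < τ, DifferentiableOn ℝ (iteratedDeriv j h) (Set.Ioo (-1) 1))
    (hnonneg : ∀ t ∈ Set.Ioo (-1 : ℝ) 1, 0 ≤ iteratedDeriv τ h t)
    (c : WeightedCode n N) (hdes : c.IsDesign τ)
    (s : ℝ) (hs : c.IsMaxInner s)
    (N₁ : ℝ) (hN₁ : N₁ = levenshteinBound n k ε s)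
    (hlow : (dgsBound n τ : ℝ) < N₁) (hupp : N₁ ≤ (dgsBound n (τ + 1) : ℝ)) :
    -- the nodes are `k + ε` distinct points of `[-1, s]`, and `τ` points with multiplicity
    (levenshteinNodes n k ε s).card = k + ε ∧
    (∀ α ∈ levenshteinNodes n k ε s, -1 ≤ α ∧ α ≤ s) ∧
    Multiset.card (interpolationNodes n k ε s) = τ ∧
    -- the Hermite interpolant `gT` exists and is unique, and it gives the bound
    ∃ gT : ℝ[X],
      (IsHermiteInterpolant h (interpolationNodes n k ε s) gT ∧
        ∀ g : ℝ[X], IsHermiteInterpolant h (interpolationNodes n k ε s) g → g = gT) ∧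
      c.energy h ≤
        (c.effectiveSize - N₁) * gT.eval 1 / (c.effectiveSize * N₁) +
          ∑ α ∈ levenshteinNodes n k ε s, levenshteinWeight n k ε s α * h α := by
  obtain ⟨i₀, j₀, hij₀, hsij⟩ := hs.1
  have hs1 : s < 1 := hsij ▸ c.inner_lt_one hij₀
  have hs2 : -1 ≤ s := hsij ▸ c.neg_one_le_inner i₀ j₀
  have hm : k + ε = (k - 1 + ε) + 1 := by lia
  have hΦ : NonnegBelow hn s (2 * k - 2 + ε) := hdes.nonnegBelow hn (by lia) hs
  have hN₁pos : 0 < N₁ := lt_of_le_of_lt (Nat.cast_nonneg _) hlow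
  rw [dgsBound_eq hn hk hε hm hτ, hN₁] at hlow
  have hden := denominator_ne_zero hn hk hε hm hs1 hlow
  obtain ⟨A, D, hT, hAcard, hDcard, hA1, hAs, hDs, hAprod, b, hb⟩ :=
    interpolationNodes_structure hn hk hε hm hs1 hΦ hlow
  have hAD : Disjoint A D := by
    rw [Finset.disjoint_left]
    intro α hα hα'
    exact (hDs α hα').1.ne' (Finset.mem_singleton.1 (hA1 hα))
  have hsAD : s ∉ A ∪ D := by
    intro hmem
    rcases Finset.mem_union.1 hmem with h1 | h1
    · exact lt_irrefl _ (hAs s h1)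
    · exact lt_irrefl _ (hDs s h1).2
  have hZval : (insert s (A ∪ D)).val = {s} + A.val + D.val := by
    rw [Finset.insert_val_of_notMem hsAD, ← Finset.disjUnion_eq_union A D hAD,
      Finset.disjUnion_val, add_assoc, Multiset.singleton_add]
  -- Every node once, plus the double nodes a second time.
  have hTZ : interpolationNodes n k ε s = (insert s (A ∪ D)).val + D.val := by
    rw [hT, hZval, two_nsmul, ← add_assoc]
  have hnodes : levenshteinNodes n k ε s = insert s (A ∪ D) := by
    rw [levenshteinNodes, hTZ]
    ext α
    simp only [Multiset.mem_toFinset, Multiset.mem_add, Finset.mem_val, Finset.mem_insert,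
      Finset.mem_union]
    tauto
  have hZcard : (insert s (A ∪ D)).card = k + ε := by
    rw [Finset.card_insert_of_notMem hsAD, Finset.card_union_of_disjoint hAD, hAcard, hDcard]
    lia
  have hTcard : Multiset.card (interpolationNodes n k ε s) = τ := by
    rw [hTZ, Multiset.card_add, Finset.card_val, Finset.card_val, hZcard, hDcard, hτ]
    lia
  have hrange (α : ℝ) (hα : α ∈ insert s (A ∪ D)) : -1 ≤ α ∧ α ≤ s := by
    rcases Finset.mem_insert.1 hα with rfl | h1
    · exact ⟨hs2, le_rfl⟩
    rcases Finset.mem_union.1 h1 with h2 | h2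
    · exact ⟨(Finset.mem_singleton.1 (hA1 h2)).ge, (hAs α h2).le⟩
    · exact ⟨(hDs α h2).1.le, (hDs α h2).2.le⟩
  obtain ⟨g, hgd, hg⟩ := exists_hermiteInterpolant (fun t j => iteratedDeriv j h t)
    (interpolationNodes n k ε s)
  have hgI : IsHermiteInterpolant h (interpolationNodes n k ε s) g := ⟨hgd, hg⟩
  refine ⟨hnodes ▸ hZcard, hnodes ▸ hrange, hTcard, g, ⟨hgI, fun g' hg' => hg'.unique hgI⟩, ?_⟩
  have hle (x : ℝ) (hx : x ∈ Set.Icc (-1) s) : h x ≤ g.eval x := by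
    refine le_eval_of_isHermiteInterpolant hcont (by rwa [hTcard]) (by rwa [hTcard]) hTZ
      (fun α hα => Finset.mem_insert_of_mem (Finset.mem_union_right _ hα))
      (fun α hα => ⟨(hrange α hα).1, (hrange α hα).2.trans_lt hs1⟩)
      (fun α hα => ⟨(hDs α hα).1, (hDs α hα).2.trans hs1⟩) (by lia) hgI ⟨hx.1, hx.2.trans_lt hs1⟩ ?_
    -- On [-1, s] the nodal product is (x - s) ≤ 0 times (x + 1)^ε ≥ 0 times a square.
    rw [hT, two_nsmul]
    simp only [Multiset.map_add, Multiset.map_singleton, Multiset.prod_add,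
      Multiset.prod_singleton, eval_mul, eval_sub, eval_X, eval_C]
    have hAeval : 0 ≤ ((A.val.map fun t => X - C t).prod : ℝ[X]).eval x := by
      change 0 ≤ (∏ α ∈ A, (X - C α) : ℝ[X]).eval x
      rw [eval_prod]
      refine Finset.prod_nonneg fun α hα => ?_
      rw [Finset.mem_singleton.1 (hA1 hα)]
      simp
      linarith [hx.1]
    have h1 : 0 ≤ s - x := by linarith [hx.2]
    nlinarith [mul_nonneg (mul_nonneg h1 hAeval)
      (mul_self_nonneg (((D.val.map fun t => X - C t).prod : ℝ[X]).eval x))]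
  have hnodal : levenshteinNodal n k ε s = C b * ∏ α ∈ levenshteinNodes n k ε s, (X - C α) := by
    rw [levenshteinNodal, hAprod, hb, hnodes, Finset.prod_insert hsAD, Finset.prod_union hAD]
    ring
  have hquad := gegenbauerMean_eq_quadrature hn hk hε hm hs1 hden (hN₁ ▸ hN₁pos.ne')
    (hnodes ▸ hZcard) hnodal (g := g) (by rw [hTcard, hτ] at hgd; exact hgd)
  have hsum : ∑ α ∈ levenshteinNodes n k ε s, levenshteinWeight n k ε s α * g.eval α =
      ∑ α ∈ levenshteinNodes n k ε s, levenshteinWeight n k ε s α * h α := by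
    refine Finset.sum_congr rfl fun α hα => ?_
    have hα' : α ∈ interpolationNodes n k ε s := Multiset.mem_toFinset.1 hα
    have := hg α hα' 0 (Multiset.count_pos.2 hα')
    simp only [Function.iterate_zero, id, iteratedDeriv_zero] at this
    rw [this]
  have hw := c.sum_weight_sq_pos i₀
  calc c.energy h ≤ c.energy fun t => g.eval t := c.energy_mono hs hle
    _ = gegenbauerMean hn g - (∑ i, c.weight i ^ 2) * g.eval 1 := by
      rw [c.energy_eval, hdes.pairMean_eq hn]
      rw [hTcard] at hgd
      exact hgd.trans (by norm_cast; lia)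
    _ = _ := by
      rw [hquad, hsum, ← hN₁, WeightedCode.effectiveSize]
      field_simp
      ring
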